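/- Fix integers $m\ge 2$, $n\ge 1$ and $\mathbf d=(d_0,\dots,d_{m-1})\in\mathbb N^{m}$ with $d_0\ge 1$, and put $|\mathbf d|=\sum_s d_s$. Identify $\mathbb Z_m=\mathbb Z/m\mathbb Z$ with $\{0,\dots,m-1\}$, with the order $0<1<\dots<m-1$; indices $s\pm1$ are taken modulo $m$. A spin index is a pair $(s,\alpha)$ with $s\in\mathbb Z_m$ and $1\le\alpha\le d_s$. Let $\mathcal M^\bullet$ be the affine variety of tuples of complex matrices $X_s,Y_s\in\mathrm{Mat}(n\times n)$ ($s\in\mathbb Z_m$) and $V_{s,\alpha}\in\mathrm{Mat}(1\times n)$, $W_{s,\alpha}\in\mathrm{Mat}(n\times1)$ ($(s,\alpha)$ a spin index) such that all of $\mathrm{Id}+X_sY_s$, $\mathrm{Id}+Y_sX_s$, $\mathrm{Id}+W_{s,\alpha}V_{s,\alpha}$, $1+V_{s,\alpha}W_{s,\alpha}$ are invertible. On $\mathcal V_{\rm cyc}=\bigoplus_{s\in\mathbb Z_m}\mathcal V_s$, $\mathcal V_s=\mathbb C^n$, consider $X_s:\mathcal V_{s+1}\to\mathcal V_s$, $Y_s:\mathcal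 V_s\to\mathcal V_{s+1}$, and set $X=\sum_sX_s$, $Y=\sum_sY_s$. Let $\mathcal M^\circ\subset\mathcal M^\bullet$ be the open subvariety $\det X\neq0$, and on it put $Z_s=Y_s+X_s^{-1}$, $Z=\sum_sZ_s$. Equip $\mathbb C[\mathcal M^\bullet]$ and $\mathbb C[\mathcal M^\circ]$ with the quasi-Poisson bracket $\{-,-\}$, i.e. the antisymmetric $\mathbb C$-bilinear biderivation determined by $$\{(X_r)_{ij},(X_s)_{kl}\}=\tfrac12\delta_{s,r-1}(X_{r-1}X_r)_{kj}\delta_{il}-\tfrac12\delta_{s,r+1}\delta_{kj}(X_rX_{r+1})_{il},$$ $$\{(Y_r)_{ij},(Y_s)_{kl}\}=\tfrac12\delta_{s,r-1}\delta_{kj}(Y_rY_{r-1})_{il}-\tfrac12\delta_{s,r+1}(Y_{r+1}Y_r)_{kj}\delta_{il},$$ $$\{(X_r)_{ij},(Y_s)_{kl}\}=\delta_{sr}\big(\delta_{kj}\delta_{il}+\tfrac12(Y_rX_r)_{kj}\delta_{il}+\tfrac12\delta_{kj}(X_rY_r)_{il}\big)-\tfrac12\delta_{s,r-1}(X_r)_{kj}(Y_{r-1})_{il}+\tfrac12\delta_{s,r+1}(Y_{r+1})_{kj}(X_r)_{il},$$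 $$\{(X_r)_{ij},(W_{s,\alpha})_k\}=\tfrac12\delta_{s,r+1}\delta_{kj}(X_rW_{s,\alpha})_i-\tfrac12\delta_{rs}(X_r)_{kj}(W_{s,\alpha})_i,$$ $$\{(X_r)_{ij},(V_{s,\alpha})_l\}=\tfrac12\delta_{rs}(V_{s,\alpha}X_r)_j\delta_{il}-\tfrac12\delta_{s,r+1}(V_{s,\alpha})_j(X_r)_{il},$$ $$\{(Y_r)_{ij},(W_{s,\alpha})_k\}=\tfrac12\delta_{rs}\delta_{kj}(Y_rW_{s,\alpha})_i-\tfrac12\delta_{s,r+1}(Y_r)_{kj}(W_{s,\alpha})_i,$$ $$\{(Y_r)_{ij},(V_{s,\alpha})_l\}=\tfrac12\delta_{s,r+1}(V_{s,\alpha}Y_r)_j\delta_{il}-\tfrac12\delta_{rs}(V_{s,\alpha})_j(Y_r)_{il},$$ $$\{(V_{s,\alpha})_j,(V_{r,\beta})_l\}=-\tfrac12o(s,r)(V_{s,\alpha})_j(V_{r,\beta})_l-\tfrac12\delta_{sr}o(\alpha,\beta)\big((V_{r,\beta})_j(V_{s,\alpha})_l+(V_{s,\alpha})_j(V_{r,\beta})_l\big),$$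 $$\{(W_{s,\alpha})_i,(W_{r,\beta})_k\}=-\tfrac12o(s,r)(W_{r,\beta})_k(W_{s,\alpha})_i-\tfrac12\delta_{sr}o(\alpha,\beta)\big((W_{r,\beta})_k(W_{s,\alpha})_i+(W_{s,\alpha})_k(W_{r,\beta})_i\big),$$ $$\begin{aligned}\{(V_{s,\alpha})_j,(W_{r,\beta})_k\}=&\ \tfrac12o(s,r)(W_{r,\beta})_k(V_{s,\alpha})_j+\delta_{sr}\delta_{\alpha\beta}\big(\delta_{kj}+\tfrac12(W_{r,\beta})_k(V_{s,\alpha})_j+\tfrac12\delta_{kj}V_{s,\alpha}W_{r,\beta}\big)\\&+\tfrac12\delta_{sr}o(\alpha,\beta)\big(\delta_{kj}V_{s,\alpha}W_{r,\beta}+(W_{r,\beta})_k(V_{s,\alpha})_j\big),\end{aligned}$$ where $o(a,b)=\mathrm{sgn}(b-a)$. Let $\rho$ be the increasing bijection from $\{1,\dots,|\mathbf d|\}$ to the spin indices ordered lexicographically ($(s,\alpha)<(r,\beta)$ iff $s<r$, or $s=r$ and $\alpha<\beta$). For $b=0,\dots,|\mathbf d|$ let $\Phi^{(b)}_s$ be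 the $\mathcal V_s$-component of the moment map of the subquiver formed by the doubled cyclic quiver and the arrows $v_{\rho(c)},w_{\rho(c)}$, $c\le b$: namely $\Phi^{(0)}_s=(\mathrm{Id}+X_sY_s)(\mathrm{Id}+Y_{s-1}X_{s-1})^{-1}$ and, for $1\le c\le|\mathbf d|$, $\Phi^{(c)}_s=\Phi^{(c-1)}_s(\mathrm{Id}+W_{\rho(c)}V_{\rho(c)})^{-1}$ if $\rho(c)=(s,\alpha)$ for some $\alpha$, and $\Phi^{(c)}_s=\Phi^{(c-1)}_s$ otherwise. For $\mathtt L=Y$ on $\mathcal M^\bullet$, or $\mathtt L=Z$ on $\mathcal M^\circ$, put $\mathtt L^{(b)}=\Phi^{(b)}\mathtt L=\sum_s\Phi^{(b)}_s\mathtt L_{s-1}\in\mathrm{End}(\mathcal V_{\rm cyc})$ and $$\mathcal L_{\mathtt L}=\mathbb C\big[\mathrm{tr}((\mathtt L^{(b)})^k)\mid k\in\mathbb N,\ b=0,1,\dots,|\mathbf d|\big].$$ Then in both cases $\{\mathrm{tr}((\mathtt L^{(b)})^k),\mathrm{tr}((\mathtt L^{(c)})^l)\}=0$ for all $b,c\in\{0,\dots,|\mathbf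 d|\}$ and $k,l\in\mathbb N$, and $\mathcal L_{\mathtt L}$, with the restriction of $\{-,-\}$, is an abelian Poisson algebra: it is closed under the bracket, on it the bracket is a Poisson bracket, and any two of its elements Poisson commute. -/

import Mathlib

open scoped BigOperators

namespace CyclicQuiver

/-- Admissible spin indices `(s, α)`: `s` is a vertex of the cyclic quiver and `α` labels one of the
`d s` arrows `∞ → s`. The vertices `ℤ/m` are modelled by `Fin m`, whose addition and subtraction
are modulo `m` and whose linear order is `0 < 1 < ⋯ < m - 1`. -/
abbrev Spin {m : ℕ} (d : Fin m → ℕ) : Type := (s : Fin m) × Fin (d s)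

/-- The coordinate functions on the space of representations of dimension `(1, n, …, n)` of the
doubled quiver: the entries of the matrices `X_s`, `Y_s` (both `n × n`), of the row vectors
`V_{s,α}` and of the column vectors `W_{s,α}`. -/
inductive Coord (m n : ℕ) (d : Fin m → ℕ) : Type
  | x (s : Fin m) (i j : Fin n)
  | y (s : Fin m) (i j : Fin n)
  | v (a : Spin d) (i : Fin n)
  | w (a : Spin d) (i : Fin n)

section Matrices

/-! In this section `p` assigns to each coordinate its value in a commutative ring `B`. It is used
for the universal point, whose values are the coordinate functions themselves. -/

variable {m n : ℕ} {d : Fin m → ℕ} {B : Type} [CommRing B] (p : Coord m n d → B)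

/-- `X_s : 𝒱_{s+1} → 𝒱_s`. -/
def matX (s : Fin m) : Matrix (Fin n) (Fin n) B := Matrix.of fun i j => p (.x s i j)

/-- `Y_s : 𝒱_s → 𝒱_{s+1}`. -/
def matY (s : Fin m) : Matrix (Fin n) (Fin n) B := Matrix.of fun i j => p (.y s i j)

/-- The row vector `V_{s,α}`. -/
def vecV (a : Spin d) : Fin n → B := fun i => p (.v a i)

/-- The column vector `W_{s,α}`. -/
def vecW (a : Spin d) : Fin n → B := fun i => p (.w a i)

/-- `Z_s = Y_s + X_s⁻¹` (used only where `X_s` is invertible). -/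
noncomputable def matZ (s : Fin m) : Matrix (Fin n) (Fin n) B := matY p s + (matX p s)⁻¹

/-- `X = ∑ X_s ∈ End(⨁ 𝒱_s)`; the pair `(i, s)` is the `i`-th basis vector of `𝒱_s`. -/
def cycX [NeZero m] : Matrix (Fin n × Fin m) (Fin n × Fin m) B :=
  Matrix.of fun P Q => if Q.2 = P.2 + 1 then matX p P.2 P.1 Q.1 else 0

/-- `L = ∑ L_s ∈ End(⨁ 𝒱_s)` for maps `L_s : 𝒱_s → 𝒱_{s+1}`, such as `Y_s` or `Z_s`. -/
def cycUp [NeZero m] (L : Fin m → Matrix (Fin n) (Fin n) B) :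
    Matrix (Fin n × Fin m) (Fin n × Fin m) B :=
  Matrix.of fun P Q => if P.2 = Q.2 + 1 then L Q.2 P.1 Q.1 else 0

/-- `ρ`, the increasing enumeration of the spin indices, where `(s, α) < (r, β)` if `s < r`, or if
`s = r` and `α < β`. It is indexed from `0`, so `rho c` is the spin index number `c + 1`. -/
def rho (d : Fin m → ℕ) (c : Fin (∑ s, d s)) : Spin d := finSigmaFinEquiv.symm c

/-- The components `Φ^{(b)}_s`, for `b = 0, …, |d|`, of the moment map of the `b`-th subquiver: the
doubled cyclic quiver together with the arrows `v_a`, `w_a` for the first `b` spin indices `a`. -/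
noncomputable def momentMap [NeZero m] (b : Fin (∑ s, d s + 1)) :
    Fin m → Matrix (Fin n) (Fin n) B :=
  Fin.induction (motive := fun _ => Fin m → Matrix (Fin n) (Fin n) B)
    (fun s => (1 + matX p s * matY p s) * (1 + matY p (s - 1) * matX p (s - 1))⁻¹)
    (fun c prev s =>
      if (rho d c).1 = s then
        prev s * (1 + Matrix.vecMulVec (vecW p (rho d c)) (vecV p (rho d c)))⁻¹
      else prev s) b

/-- `tr ((Φ^{(b)} L)^k)`, where `Φ^{(b)} L = ∑ Φ^{(b)}_s L_{s-1} ∈ End(⨁ 𝒱_s)`. -/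
noncomputable def traceFun [NeZero m] (L : Fin m → Matrix (Fin n) (Fin n) B)
    (b : Fin (∑ s, d s + 1)) (k : ℕ) : B :=
  Matrix.trace ((Matrix.blockDiagonal (momentMap p b) * cycUp L) ^ k)

/-- The subalgebra `𝓛_L = ℂ[tr ((Φ^{(b)} L)^k) ∣ k ∈ ℕ, b = 0, …, |d|]`. -/
noncomputable def traceAlgebra [NeZero m] [Algebra ℂ B] (L : Fin m → Matrix (Fin n) (Fin n) B) :
    Subalgebra ℂ B :=
  Algebra.adjoin ℂ {F | ∃ (b : Fin (∑ s, d s + 1)) (k : ℕ), F = traceFun p L b k}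

end Matrices

section GeneratorBrackets

/-! The quasi-Poisson brackets of the coordinate functions. -/

variable {m n : ℕ} {d : Fin m → ℕ} {B : Type} [CommRing B]

/-- The Kronecker delta of a proposition. -/
def kd (P : Prop) [Decidable P] : B := if P then 1 else 0

/-- The ordering function `o(a, b) = sgn (b - a)`. -/
def ordSign {α : Type} [LinearOrder α] (a b : α) : B :=
  if a < b then 1 else if b < a then -1 else 0

/-- `δ_{sr} o(α, β)` for spin indices `a = (s, α)` and `c = (r, β)`. -/
def spinSign (a c : Spin d) : B := kd (a.1 = c.1) * ordSign (a.2 : ℕ) (c.2 : ℕ)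

variable [NeZero m] [Algebra ℂ B] (p : Coord m n d → B)

/-- `{(X_r)_{ij}, (X_s)_{kl}}` -/
noncomputable def brXX (r : Fin m) (i j : Fin n) (s : Fin m) (k l : Fin n) : B :=
  (1 / 2 : ℂ) • (kd (s = r - 1) * (matX p (r - 1) * matX p r) k j * kd (i = l))
  - (1 / 2 : ℂ) • (kd (s = r + 1) * kd (k = j) * (matX p r * matX p (r + 1)) i l)

/-- `{(Y_r)_{ij}, (Y_s)_{kl}}` -/
noncomputable def brYY (r : Fin m) (i j : Fin n) (s : Fin m) (k l : Fin n) : B :=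
  (1 / 2 : ℂ) • (kd (s = r - 1) * kd (k = j) * (matY p r * matY p (r - 1)) i l)
  - (1 / 2 : ℂ) • (kd (s = r + 1) * (matY p (r + 1) * matY p r) k j * kd (i = l))

/-- `{(X_r)_{ij}, (Y_s)_{kl}}` -/
noncomputable def brXY (r : Fin m) (i j : Fin n) (s : Fin m) (k l : Fin n) : B :=
  kd (s = r) * (kd (k = j) * kd (i = l)
    + (1 / 2 : ℂ) • ((matY p r * matX p r) k j * kd (i = l))
    + (1 / 2 : ℂ) • (kd (k = j) * (matX p r * matY p r) i l))
  - (1 / 2 : ℂ) • (kd (s = r - 1) * matX p r k j * matY p (r - 1) i l)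
  + (1 / 2 : ℂ) • (kd (s = r + 1) * matY p (r + 1) k j * matX p r i l)

/-- `{(X_r)_{ij}, (W_{s,α})_k}` for `a = (s, α)` -/
noncomputable def brXW (r : Fin m) (i j : Fin n) (a : Spin d) (k : Fin n) : B :=
  (1 / 2 : ℂ) • (kd (a.1 = r + 1) * kd (k = j) * (matX p r).mulVec (vecW p a) i)
  - (1 / 2 : ℂ) • (kd (r = a.1) * matX p r k j * vecW p a i)

/-- `{(X_r)_{ij}, (V_{s,α})_l}` for `a = (s, α)` -/
noncomputable def brXV (r : Fin m) (i j : Fin n) (a : Spin d) (l : Fin n) : B :=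
  (1 / 2 : ℂ) • (kd (r = a.1) * Matrix.vecMul (vecV p a) (matX p r) j * kd (i = l))
  - (1 / 2 : ℂ) • (kd (a.1 = r + 1) * vecV p a j * matX p r i l)

/-- `{(Y_r)_{ij}, (W_{s,α})_k}` for `a = (s, α)` -/
noncomputable def brYW (r : Fin m) (i j : Fin n) (a : Spin d) (k : Fin n) : B :=
  (1 / 2 : ℂ) • (kd (r = a.1) * kd (k = j) * (matY p r).mulVec (vecW p a) i)
  - (1 / 2 : ℂ) • (kd (a.1 = r + 1) * matY p r k j * vecW p a i)

/-- `{(Y_r)_{ij}, (V_{s,α})_l}` for `a = (s, α)` -/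
noncomputable def brYV (r : Fin m) (i j : Fin n) (a : Spin d) (l : Fin n) : B :=
  (1 / 2 : ℂ) • (kd (a.1 = r + 1) * Matrix.vecMul (vecV p a) (matY p r) j * kd (i = l))
  - (1 / 2 : ℂ) • (kd (r = a.1) * vecV p a j * matY p r i l)

/-- `{(V_{s,α})_j, (V_{r,β})_l}` for `a = (s, α)`, `c = (r, β)` -/
noncomputable def brVV (a : Spin d) (j : Fin n) (c : Spin d) (l : Fin n) : B :=
  -((1 / 2 : ℂ) • (ordSign a.1 c.1 * vecV p a j * vecV p c l))
  - (1 / 2 : ℂ) • (spinSign a c * (vecV p c j * vecV p a l + vecV p a j * vecV p c l))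

/-- `{(W_{s,α})_i, (W_{r,β})_k}` for `a = (s, α)`, `c = (r, β)` -/
noncomputable def brWW (a : Spin d) (i : Fin n) (c : Spin d) (k : Fin n) : B :=
  -((1 / 2 : ℂ) • (ordSign a.1 c.1 * vecW p c k * vecW p a i))
  - (1 / 2 : ℂ) • (spinSign a c * (vecW p c k * vecW p a i + vecW p a k * vecW p c i))

/-- `{(V_{s,α})_j, (W_{r,β})_k}` for `a = (s, α)`, `c = (r, β)` -/
noncomputable def brVW (a : Spin d) (j : Fin n) (c : Spin d) (k : Fin n) : B :=
  (1 / 2 : ℂ) • (ordSign a.1 c.1 * vecW p c k * vecV p a j)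
  + kd (a = c) * (kd (k = j) + (1 / 2 : ℂ) • (vecW p c k * vecV p a j)
    + (1 / 2 : ℂ) • (kd (k = j) * (vecV p a ⬝ᵥ vecW p c)))
  + (1 / 2 : ℂ) • (spinSign a c *
    (kd (k = j) * (vecV p a ⬝ᵥ vecW p c) + vecW p c k * vecV p a j))

/-- The bracket of two coordinate functions; the pairs not listed above are given by
antisymmetry. -/
noncomputable def coordBracket : Coord m n d → Coord m n d → B
  | .x r i j, .x s k l => brXX p r i j s k l
  | .y r i j, .y s k l => brYY p r i j s k l
  | .x r i j, .y s k l => brXY p r i j s k l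
  | .y s k l, .x r i j => -brXY p r i j s k l
  | .x r i j, .w a k => brXW p r i j a k
  | .w a k, .x r i j => -brXW p r i j a k
  | .x r i j, .v a l => brXV p r i j a l
  | .v a l, .x r i j => -brXV p r i j a l
  | .y r i j, .w a k => brYW p r i j a k
  | .w a k, .y r i j => -brYW p r i j a k
  | .y r i j, .v a l => brYV p r i j a l
  | .v a l, .y r i j => -brYV p r i j a l
  | .v a j, .v c l => brVV p a j c l
  | .w a i, .w c k => brWW p a i c k
  | .v a j, .w c k => brVW p a j c k
  | .w c k, .v a j => -brVW p a j c k

end GeneratorBrackets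

section CoordinateRings

/-- The ring of regular functions on the affine space of all `(X_s, Y_s, V_{s,α}, W_{s,α})`. -/
abbrev PolyRing (m n : ℕ) (d : Fin m → ℕ) : Type := MvPolynomial (Coord m n d) ℂ

/-- The ring of regular functions on the open subvariety of that affine space where the polynomial
`f` does not vanish. -/
abbrev RegFun {m n : ℕ} {d : Fin m → ℕ} (f : PolyRing m n d) : Type := Localization.Away f

/-- The coordinate functions, as regular functions on the open subvariety `f ≠ 0`. -/
noncomputable def coord {m n : ℕ} {d : Fin m → ℕ} (f : PolyRing m n d) (c : Coord m n d) :
    RegFun f :=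
  algebraMap (PolyRing m n d) (RegFun f) (MvPolynomial.X c)

/-- The product of the determinants of `1 + X_s Y_s`, `1 + Y_s X_s`, `1 + W_{s,α} V_{s,α}` and
`1 + V_{s,α} W_{s,α}`; the variety `𝓜^•` is the open subvariety where it does not vanish. -/
noncomputable def denBullet (m n : ℕ) (d : Fin m → ℕ) : PolyRing m n d :=
  (∏ s : Fin m, (1 + matX MvPolynomial.X s * matY MvPolynomial.X s).det
      * (1 + matY MvPolynomial.X s * matX MvPolynomial.X s).det)
  * ∏ a : Spin d, (1 + Matrix.vecMulVec (vecW MvPolynomial.X a) (vecV MvPolynomial.X a)).det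
      * (1 + vecV MvPolynomial.X a ⬝ᵥ vecW MvPolynomial.X a)

/-- The variety `𝓜^∘` is the open subvariety of `𝓜^•` where `det X ≠ 0`. -/
noncomputable def denCirc (m n : ℕ) [NeZero m] (d : Fin m → ℕ) : PolyRing m n d :=
  denBullet m n d * (cycX MvPolynomial.X).det

variable {m n : ℕ} {d : Fin m → ℕ} (f : PolyRing m n d)

/-- The homomorphism `F ↦ F + ε D(F)` to the dual numbers over the ring of regular functions, where
`D` is the vector field sending each coordinate function `c` to `u c`. -/
noncomputable def dualHom (u : Coord m n d → RegFun f) :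
    RegFun f →ₐ[ℂ] TrivSqZeroExt (RegFun f) (RegFun f) :=
  IsLocalization.liftAlgHom (M := Submonoid.powers f)
    (f := MvPolynomial.aeval
      fun c => TrivSqZeroExt.inl (coord f c) + TrivSqZeroExt.inr (u c)) <| by
    have key : ((TrivSqZeroExt.fstHom ℂ (RegFun f) (RegFun f)).comp (MvPolynomial.aeval
        fun c => TrivSqZeroExt.inl (coord f c) + TrivSqZeroExt.inr (u c)))
        = IsScalarTower.toAlgHom ℂ (PolyRing m n d) (RegFun f) := by
      ext c
      simp [coord]
    intro g
    rw [TrivSqZeroExt.isUnit_iff_isUnit_fst]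
    have h := DFunLike.congr_fun key (g : PolyRing m n d)
    have h2 : IsUnit (algebraMap (PolyRing m n d) (RegFun f) g) :=
      IsLocalization.map_units (RegFun f) g
    simp only [AlgHom.comp_apply, TrivSqZeroExt.fstHom_apply, IsScalarTower.coe_toAlgHom'] at h
    rw [h]
    exact h2

theorem dualHom_coord (u : Coord m n d → RegFun f) (c : Coord m n d) :
    dualHom f u (coord f c) = TrivSqZeroExt.inl (coord f c) + TrivSqZeroExt.inr (u c) := by
  simp [dualHom, coord]

theorem fst_dualHom (u : Coord m n d → RegFun f) (F : RegFun f) : (dualHom f u F).fst = F := by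
  have key : (TrivSqZeroExt.fstHom ℂ (RegFun f) (RegFun f)).comp (dualHom f u)
      = AlgHom.id ℂ (RegFun f) := by
    apply IsLocalization.algHom_ext (Submonoid.powers f)
    ext c
    have h := congrArg TrivSqZeroExt.fst (dualHom_coord f u c)
    rw [TrivSqZeroExt.fst_add, TrivSqZeroExt.fst_inl, TrivSqZeroExt.fst_inr, add_zero] at h
    exact h
  exact DFunLike.congr_fun key F

/-- The vector field (derivation) on the open subvariety `f ≠ 0` that sends each coordinate
function `c` to `u c`. -/
noncomputable def vectorField (u : Coord m n d → RegFun f) :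
    Derivation ℂ (RegFun f) (RegFun f) :=
  Derivation.mk' ((TrivSqZeroExt.sndHom (RegFun f) (RegFun f)).restrictScalars ℂ ∘ₗ
      (dualHom f u).toLinearMap) <| by
    intro F G
    simp [fst_dualHom, mul_comm]

theorem vectorField_coord (u : Coord m n d → RegFun f) (c : Coord m n d) :
    vectorField f u (coord f c) = u c := by
  simp [vectorField, dualHom_coord]

/-- The quasi-Poisson bracket `{F, G}` of regular functions on the open subvariety `f ≠ 0`: the
biderivation extending `coordBracket` from the coordinate functions. For each coordinate function
`c`, the map `{c, -}` is the vector field sending `c'` to `{c, c'}`, and `{-, G}` is the vector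
field sending `c` to `{c, G}`. -/
noncomputable def bracket [NeZero m] (F G : RegFun f) : RegFun f :=
  vectorField f (fun c => vectorField f (coordBracket (coord f) c) G) F

theorem bracket_coord [NeZero m] (a b : Coord m n d) :
    bracket f (coord f a) (coord f b) = coordBracket (coord f) a b := by
  simp [bracket, vectorField_coord]

end CoordinateRings

/-- The subalgebra `S` is an abelian Poisson algebra for the restriction of the bracket `br`: it is
closed under `br`, on it `br` is bilinear, antisymmetric, and satisfies the Leibniz and Jacobi
identities, and any two elements of it Poisson commute. -/
structure IsAbelianPoissonAlgebra {A : Type} [CommRing A] [Algebra ℂ A] (br : A → A → A)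
    (S : Subalgebra ℂ A) : Prop where
  closed : ∀ F ∈ S, ∀ G ∈ S, br F G ∈ S
  add_left : ∀ F ∈ S, ∀ G ∈ S, ∀ H ∈ S, br (F + G) H = br F H + br G H
  smul_left : ∀ (z : ℂ), ∀ F ∈ S, ∀ G ∈ S, br (z • F) G = z • br F G
  skew : ∀ F ∈ S, ∀ G ∈ S, br F G = -br G F
  leibniz : ∀ F ∈ S, ∀ G ∈ S, ∀ H ∈ S, br (F * G) H = F * br G H + br F H * G
  jacobi : ∀ F ∈ S, ∀ G ∈ S, ∀ H ∈ S, br F (br G H) + br G (br H F) + br H (br F G) = 0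
  abelian : ∀ F ∈ S, ∀ G ∈ S, br F G = 0

end CyclicQuiver

namespace CyclicQuiver

open Matrix
open scoped Kronecker

set_option linter.unusedSectionVars false

/-! The brackets `{A i j, C k l}` of the entries of two matrices form an element `dbl br A C` of
`End ⊗ End`, a double bracket in the sense of Van den Bergh, with a Leibniz rule in each argument.
Here `br` is twice the quasi-Poisson bracket, which removes the halves. With `S = ∑ e_r ⊗ e_r` and
`N = S * (ι₁ Φ + ι₂ Φ)`, the moment map property of `Φ` says that `dbl br Φ x` is the inner double
derivation `ι₁ x * N - N * ι₂ x`. Contracting the two legs kills it, so the entries of `Φ` Poisson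
commute with the trace of `x` (`IsMomentFor.ham_trace`).

Let `b ≤ c` and `F = tr ((Φ b * L) ^ p)`. Everything in `F` lives on the `b`-th subquiver, hence on
the `c`-th, so `Φ c` is a moment map for `Φ b * L` and its entries commute with `F`
(`FramedCyclic.moment_Φ`). The entries of `L` also commute with `F` (`ham_trace_pow_eq_zero`): this
uses the quadratic relation for `dbl br L L`, the moment property of `Φ b` on `L`, and the fact that
`L` shifts the vertices by one. So the derivation `{F, -}` kills all entries of `Φ c * L`, and with
them the traces of its powers. The case `L = Z` needs only that `Z` obeys the quadratic relation of
`Y` (`IsCyclicPair.zz`).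

The moment property of the partial products `Φ b` is proved by fusion. It holds for `(1 + X Y) (1 +
Y X)⁻¹` on the cyclic quiver, and it survives multiplication by `(1 + W V)⁻¹` because all earlier
arrows have with `1 + W V` the bracket prescribed by `Precedes`.

Once the generators commute, the bracket vanishes on the whole generated algebra. The Jacobi
identity is then trivial, and the failure of Jacobi for a quasi-Poisson bracket never enters. -/

/-- A skew-symmetric biderivation of a commutative `ℂ`-algebra. -/
structure SkewBiderivation (B : Type*) [CommRing B] [Algebra ℂ B] where
  /-- The derivation `{F, -}`. -/
  ham : B → Derivation ℂ B B
  skew : ∀ F G, ham F G = -ham G F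

/-! ### Double brackets of matrices and the moment map condition. -/

section DoubleBracket

variable {B : Type*} [CommRing B] [Algebra ℂ B] {I : Type*} [Fintype I] [DecidableEq I]

/-- `A ⊗ 1`. -/
def fstLeg (A : Matrix I I B) : Matrix (I × I) (I × I) B := A ⊗ₖ 1

/-- `1 ⊗ A`. -/
def sndLeg (A : Matrix I I B) : Matrix (I × I) (I × I) B := 1 ⊗ₖ A

local notation "ι₁" => fstLeg
local notation "ι₂" => sndLeg

theorem fstLeg_mul (A C : Matrix I I B) : ι₁ (A * C) = ι₁ A * ι₁ C := by
  simp [fstLeg, ← mul_kronecker_mul]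

theorem sndLeg_mul (A C : Matrix I I B) : ι₂ (A * C) = ι₂ A * ι₂ C := by
  simp [sndLeg, ← mul_kronecker_mul]

theorem fstLeg_add (A C : Matrix I I B) : ι₁ (A + C) = ι₁ A + ι₁ C := add_kronecker _ _ _

theorem sndLeg_add (A C : Matrix I I B) : ι₂ (A + C) = ι₂ A + ι₂ C := kronecker_add _ _ _

@[simp] theorem fstLeg_one : ι₁ (1 : Matrix I I B) = 1 := by simp [fstLeg]

@[simp] theorem sndLeg_one : ι₂ (1 : Matrix I I B) = 1 := by simp [sndLeg]

theorem sndLeg_mul_fstLeg (A C : Matrix I I B) : ι₂ A * ι₁ C = ι₁ C * ι₂ A := by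
  simp [fstLeg, sndLeg, ← mul_kronecker_mul]

theorem sndLeg_mul_fstLeg_assoc (A C : Matrix I I B) (M : Matrix (I × I) (I × I) B) :
    ι₂ A * (ι₁ C * M) = ι₁ C * (ι₂ A * M) := by
  rw [← mul_assoc, sndLeg_mul_fstLeg, mul_assoc]

/-- The exchange of the two tensor factors. -/
def flip : Matrix (I × I) (I × I) B ≃ₐ[B] Matrix (I × I) (I × I) B :=
  reindexAlgEquiv B B (Equiv.prodComm I I)

theorem flip_apply (M : Matrix (I × I) (I × I) B) (P Q : I × I) :
    flip M P Q = M P.swap Q.swap := rfl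

@[simp] theorem flip_fstLeg (A : Matrix I I B) : flip (ι₁ A) = ι₂ A := by
  ext ⟨i, j⟩ ⟨k, l⟩
  simp [flip_apply, fstLeg, sndLeg, mul_comm]

@[simp] theorem flip_sndLeg (A : Matrix I I B) : flip (ι₂ A) = ι₁ A := by
  ext ⟨i, j⟩ ⟨k, l⟩
  simp [flip_apply, fstLeg, sndLeg, mul_comm]

variable (br : SkewBiderivation B)

/-- The double bracket of two matrices, with entries `{A i j, C k l}`. -/
def dbl (A C : Matrix I I B) : Matrix (I × I) (I × I) B :=
  of fun P Q => br.ham (A P.2 Q.1) (C P.1 Q.2)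

theorem flip_dbl (A C : Matrix I I B) : flip (dbl br A C) = -dbl br C A := by
  ext ⟨i, j⟩ ⟨k, l⟩
  simp only [flip_apply, dbl, of_apply, Prod.swap]
  exact br.skew _ _

theorem dbl_swap (A C : Matrix I I B) : dbl br C A = -flip (dbl br A C) := by
  rw [flip_dbl, neg_neg]

/-- In the second argument the Leibniz rule uses the outer bimodule structure (left action on leg
one, right action on leg two). In the first argument it uses the inner one, obtained by `flip`. -/
theorem dbl_mul_right (A C C' : Matrix I I B) :
    dbl br A (C * C') = ι₁ C * dbl br A C' + dbl br A C * ι₂ C' := by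
  ext ⟨k, i⟩ ⟨j, l⟩
  simp [dbl, mul_apply, fstLeg, sndLeg, Fintype.sum_prod_type, one_apply, Finset.sum_add_distrib,
    mul_comm]

theorem dbl_add_right (A C C' : Matrix I I B) :
    dbl br A (C + C') = dbl br A C + dbl br A C' := by
  ext ⟨k, i⟩ ⟨j, l⟩
  simp [dbl]

theorem dbl_one_right (A : Matrix I I B) : dbl br A 1 = 0 := by
  ext ⟨k, i⟩ ⟨j, l⟩
  by_cases h : k = l <;> simp [dbl, one_apply, h]

theorem dbl_mul_left (A A' C : Matrix I I B) :
    dbl br (A * A') C = ι₂ A * dbl br A' C + dbl br A C * ι₁ A' := by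
  rw [dbl_swap, dbl_mul_right, map_add, map_mul, map_mul, flip_dbl, flip_dbl]
  simp [add_comm]

theorem dbl_add_left (A A' C : Matrix I I B) :
    dbl br (A + A') C = dbl br A C + dbl br A' C := by
  rw [dbl_swap, dbl_add_right, map_add, flip_dbl, flip_dbl]
  simp [add_comm]

theorem dbl_one_left (A : Matrix I I B) : dbl br 1 A = 0 := by
  rw [dbl_swap, dbl_one_right, map_zero, neg_zero]

theorem dbl_inv_left {A K : Matrix I I B} (h : A * K = 1) (C : Matrix I I B) :
    dbl br K C = -(ι₂ K * dbl br A C * ι₁ K) := by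
  have h' : K * A = 1 := mul_eq_one_comm.mp h
  have e := dbl_mul_left br K A C
  rw [h', dbl_one_left] at e
  have e2 : ι₁ A * ι₁ K = 1 := by rw [← fstLeg_mul, h, fstLeg_one]
  calc dbl br K C = dbl br K C * (ι₁ A * ι₁ K) := by rw [e2, mul_one]
    _ = (ι₂ K * dbl br A C + dbl br K C * ι₁ A) * ι₁ K - ι₂ K * dbl br A C * ι₁ K := by
      noncomm_ring
    _ = _ := by rw [← e]; noncomm_ring

theorem dbl_inv_right {A K : Matrix I I B} (h : A * K = 1) (C : Matrix I I B) :
    dbl br C K = -(ι₁ K * dbl br C A * ι₂ K) := by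
  rw [dbl_swap, dbl_inv_left br h, map_neg, map_mul, map_mul, flip_dbl]
  simp

section Moment

variable (S : Matrix (I × I) (I × I) B)

/-- The moment map condition on `Φ`, tested on `x`. -/
def IsMomentFor (Φ x : Matrix I I B) : Prop :=
  dbl br Φ x = ι₁ x * (S * (ι₁ Φ + ι₂ Φ)) - S * (ι₁ Φ + ι₂ Φ) * ι₂ x

/-- The double bracket of `x` with `g` when the vertices of `x` are fused to those of `g`. -/
def Precedes (x g : Matrix I I B) : Prop :=
  dbl br x g = ι₂ x * (S * (ι₂ g - ι₁ g)) - S * (ι₂ g - ι₁ g) * ι₁ x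

variable {br S}

/-- For fixed `Φ` both sides of the condition are outer double derivations in `x`. Hence it
propagates from generators to sums, products and inverses. -/
theorem IsMomentFor.mul {Φ x y : Matrix I I B} (hx : IsMomentFor br S Φ x)
    (hy : IsMomentFor br S Φ y) : IsMomentFor br S Φ (x * y) := by
  unfold IsMomentFor at *
  rw [dbl_mul_right, hx, hy, fstLeg_mul, sndLeg_mul]
  noncomm_ring

theorem IsMomentFor.add {Φ x y : Matrix I I B} (hx : IsMomentFor br S Φ x)
    (hy : IsMomentFor br S Φ y) : IsMomentFor br S Φ (x + y) := by
  unfold IsMomentFor at *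
  rw [dbl_add_right, hx, hy, fstLeg_add, sndLeg_add]
  noncomm_ring

theorem fstLeg_mul_fstLeg_of {A K : Matrix I I B} (h : A * K = 1) : ι₁ A * ι₁ K = 1 := by
  rw [← fstLeg_mul, h, fstLeg_one]

theorem sndLeg_mul_sndLeg_of {A K : Matrix I I B} (h : A * K = 1) : ι₂ A * ι₂ K = 1 := by
  rw [← sndLeg_mul, h, sndLeg_one]

theorem IsMomentFor.inv {Φ x y : Matrix I I B} (hx : IsMomentFor br S Φ x)
    (h : x * y = 1) : IsMomentFor br S Φ y := by
  unfold IsMomentFor at *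
  rw [dbl_inv_right br h, hx, mul_sub, sub_mul]
  generalize S * (ι₁ Φ + ι₂ Φ) = N
  have e1 := fstLeg_mul_fstLeg_of (mul_eq_one_comm.mp h)
  have e2 := sndLeg_mul_sndLeg_of h
  have : ι₁ y * (N * ι₂ x) * ι₂ y = ι₁ y * N := by
    rw [mul_assoc, mul_assoc N, e2, mul_one]
  rw [this, ← mul_assoc, e1, one_mul]
  abel

/-- For fixed `g` both sides are derivations in `x` for the inner structure, so again generators
suffice. -/
theorem Precedes.mul {g x y : Matrix I I B} (hx : Precedes br S x g)
    (hy : Precedes br S y g) : Precedes br S (x * y) g := by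
  unfold Precedes at *
  rw [dbl_mul_left, hx, hy, fstLeg_mul, sndLeg_mul]
  noncomm_ring

theorem Precedes.add {g x y : Matrix I I B} (hx : Precedes br S x g)
    (hy : Precedes br S y g) : Precedes br S (x + y) g := by
  unfold Precedes at *
  rw [dbl_add_left, hx, hy, fstLeg_add, sndLeg_add]
  noncomm_ring

theorem Precedes.one (g : Matrix I I B) : Precedes br S 1 g := by
  unfold Precedes
  rw [dbl_one_left]
  simp

theorem IsMomentFor.one (Φ : Matrix I I B) : IsMomentFor br S Φ 1 := by
  unfold IsMomentFor
  rw [dbl_one_right]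
  simp

theorem Precedes.inv {g x y : Matrix I I B} (hx : Precedes br S x g)
    (h : x * y = 1) : Precedes br S y g := by
  unfold Precedes at *
  rw [dbl_inv_left br h, hx, mul_sub, sub_mul]
  generalize S * (ι₂ g - ι₁ g) = N
  have e1 := fstLeg_mul_fstLeg_of h
  have e2 := sndLeg_mul_sndLeg_of (mul_eq_one_comm.mp h)
  have : ι₂ y * (N * ι₁ x) * ι₁ y = ι₂ y * N := by
    rw [mul_assoc, mul_assoc N, e1, mul_one]
  rw [this, ← mul_assoc, e2, one_mul]
  abel

/-- `A` has degree zero: both `A ⊗ 1` and `1 ⊗ A` commute with `S`. -/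
def IsEven (S : Matrix (I × I) (I × I) B) (A : Matrix I I B) : Prop :=
  ι₁ A * S = S * ι₁ A ∧ ι₂ A * S = S * ι₂ A

theorem IsEven.one : IsEven S (1 : Matrix I I B) := by simp [IsEven]

theorem IsEven.add {A C : Matrix I I B} (hA : IsEven S A) (hC : IsEven S C) :
    IsEven S (A + C) := by
  simp only [IsEven, fstLeg_add, sndLeg_add, add_mul, mul_add, hA.1, hA.2, hC.1, hC.2, and_self]

theorem IsEven.mul {A C : Matrix I I B} (hA : IsEven S A) (hC : IsEven S C) :
    IsEven S (A * C) := by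
  rw [IsEven, fstLeg_mul, sndLeg_mul]
  constructor
  · rw [mul_assoc, hC.1, ← mul_assoc, hA.1, mul_assoc]
  · rw [mul_assoc, hC.2, ← mul_assoc, hA.2, mul_assoc]

theorem comm_of_inv {T : Type*} [Ring T] {a k s : T} (h : a * k = 1) (h' : k * a = 1)
    (hs : a * s = s * a) : k * s = s * k := by
  calc k * s = k * s * (a * k) := by rw [h, mul_one]
    _ = k * (s * a) * k := by noncomm_ring
    _ = s * k := by rw [← hs, ← mul_assoc, h', one_mul]

theorem IsEven.inv {A K : Matrix I I B} (hA : IsEven S A) (h : A * K = 1) : IsEven S K :=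
  have h' := mul_eq_one_comm.mp h
  ⟨comm_of_inv (fstLeg_mul_fstLeg_of h) (fstLeg_mul_fstLeg_of h') hA.1,
    comm_of_inv (sndLeg_mul_sndLeg_of h) (sndLeg_mul_sndLeg_of h') hA.2⟩

end Moment
end DoubleBracket

local notation "ι₁" => fstLeg
local notation "ι₂" => sndLeg

/-! ### Fusion of moment maps. -/

section Fusion

variable {B : Type*} [CommRing B] [Algebra ℂ B] {I : Type*} [Fintype I] [DecidableEq I]
  {br : SkewBiderivation B} {S : Matrix (I × I) (I × I) B}

theorem mul_eq_mul_assoc {T : Type*} [Semigroup T] {a b c d : T} (h : a * b = c * d) (z : T) :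
    a * (b * z) = c * (d * z) := by
  rw [← mul_assoc, h, mul_assoc]

theorem mul_eq_one_assoc {T : Type*} [Monoid T] {a b : T} (h : a * b = 1) (z : T) :
    a * (b * z) = z := by
  rw [← mul_assoc, h, one_mul]

/-- Multiplying `S * (ι₂ g - ι₁ g)` by `ι₁ g⁻¹` on the left and `ι₂ g⁻¹` on the right gives minus
the same expression in `g⁻¹`. This sign cancels the one in `dbl_inv_right`. -/
theorem Precedes.inv_right {g k x : Matrix I I B} (hx : Precedes br S x g) (hg : IsEven S g)
    (h : g * k = 1) : Precedes br S x k := by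
  have hk := hg.inv h
  have h' := mul_eq_one_comm.mp h
  unfold Precedes at *
  rw [dbl_inv_right br h, hx]
  have e : ι₁ k * (S * (ι₂ g - ι₁ g)) * ι₂ k = -(S * (ι₂ k - ι₁ k)) := by
    simp only [mul_sub, sub_mul, mul_assoc, mul_eq_mul_assoc hk.1, sndLeg_mul_sndLeg_of h,
      mul_one, mul_eq_one_assoc (fstLeg_mul_fstLeg_of h')]
    abel
  have e1 : ι₁ k * (ι₂ x * (S * (ι₂ g - ι₁ g)) - S * (ι₂ g - ι₁ g) * ι₁ x) * ι₂ k
      = ι₂ x * (ι₁ k * (S * (ι₂ g - ι₁ g)) * ι₂ k)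
        - (ι₁ k * (S * (ι₂ g - ι₁ g)) * ι₂ k) * ι₁ x := by
    generalize S * (ι₂ g - ι₁ g) = N
    simp only [mul_sub, sub_mul, mul_assoc, sndLeg_mul_fstLeg, sndLeg_mul_fstLeg_assoc]
  rw [e1, e]
  noncomm_ring

/-- Fusion: multiplying by the moment map of a later piece keeps the moment map property. -/
theorem IsMomentFor.mul_inv_of_precedes (hS : flip S = S) {φ g k x : Matrix I I B}
    (hφ : IsMomentFor br S φ x) (hx : Precedes br S x g) (eφ : IsEven S φ) (eg : IsEven S g)
    (h : g * k = 1) : IsMomentFor br S (φ * k) x := by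
  have hk := eg.inv h
  have hxk := hx.inv_right eg h
  have d : dbl br k x = ι₁ x * (S * (ι₂ k - ι₁ k)) - S * (ι₂ k - ι₁ k) * ι₂ x := by
    unfold Precedes at hxk
    rw [dbl_swap, hxk]
    simp only [map_sub, map_mul, hS, flip_fstLeg, flip_sndLeg]
    noncomm_ring
  unfold IsMomentFor at *
  -- The mixed terms in `ι₂ φ` and `ι₁ k` coming from the two factors cancel. What remains involves
  -- `φ * k` in a single leg.
  rw [dbl_mul_left, d, hφ]
  simp only [mul_add, mul_sub, add_mul, sub_mul, mul_assoc, fstLeg_mul, sndLeg_mul,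
    sndLeg_mul_fstLeg, sndLeg_mul_fstLeg_assoc, mul_eq_mul_assoc eφ.2]
  abel

/-- The case of the arrow attached last: `φ` does not act on `g` as a moment map but only precedes
it, and the quadratic self-bracket of `g` supplies the missing terms. -/
theorem IsMomentFor.mul_inv_self {φ g k : Matrix I I B} (hφ : Precedes br S φ g)
    (hg : dbl br g g = S * (ι₂ g * ι₂ g) - S * (ι₁ g * ι₁ g))
    (eφ : IsEven S φ) (eg : IsEven S g)
    (h : g * k = 1) : IsMomentFor br S (φ * k) g := by
  have hk := eg.inv h
  have h' := mul_eq_one_comm.mp h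
  have d : dbl br k g = -(S * (ι₁ k * ι₂ g) - S * (ι₂ k * ι₁ g)) := by
    rw [dbl_inv_left br h, hg]
    simp only [mul_sub, sub_mul, mul_assoc, mul_eq_mul_assoc hk.2, sndLeg_mul_fstLeg,
      mul_eq_one_assoc (fstLeg_mul_fstLeg_of h), mul_eq_one_assoc (sndLeg_mul_sndLeg_of h'),
      sndLeg_mul_fstLeg_assoc]
  unfold Precedes at hφ
  unfold IsMomentFor
  rw [dbl_mul_left, d, hφ]
  simp only [mul_add, mul_sub, mul_neg, add_mul, sub_mul, mul_assoc, fstLeg_mul, sndLeg_mul,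
    sndLeg_mul_fstLeg, sndLeg_mul_fstLeg_assoc, mul_eq_mul_assoc eφ.2, mul_eq_mul_assoc eg.1,
    mul_eq_one_assoc (fstLeg_mul_fstLeg_of h), sndLeg_mul_sndLeg_of h',
    mul_one]
  abel

end Fusion

/-! ### The doubled cyclic quiver: its moment map and the element `Z`. -/

section Cyclic

variable {B : Type*} [CommRing B] [Algebra ℂ B] {I : Type*} [Fintype I] [DecidableEq I]

/-- Commutation of matrices that raise the degree (`y`) or lower it (`x`) with
`S = ∑ e_r ⊗ e_r` and `U = ∑ e_{r+1} ⊗ e_r`. -/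
structure IsRaising (S U : Matrix (I × I) (I × I) B) (y : Matrix I I B) : Prop where
  fst_left : ι₁ y * S = U * ι₁ y
  fst_right : S * ι₁ y = ι₁ y * flip U
  snd_left : ι₂ y * S = flip U * ι₂ y
  snd_right : S * ι₂ y = ι₂ y * U

structure IsLowering (S U : Matrix (I × I) (I × I) B) (x : Matrix I I B) : Prop where
  fst_left : ι₁ x * U = S * ι₁ x
  fst_right : flip U * ι₁ x = ι₁ x * S
  snd_left : ι₂ x * flip U = S * ι₂ x
  snd_right : U * ι₂ x = ι₂ x * S

variable {br : SkewBiderivation B} {S U : Matrix (I × I) (I × I) B} {X Y : Matrix I I B}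

theorem IsLowering.isEven_mul (hX : IsLowering S U X) (hY : IsRaising S U Y) :
    IsEven S (X * Y) := by
  rw [IsEven, fstLeg_mul, sndLeg_mul]
  constructor
  · rw [mul_assoc, hY.fst_left, ← mul_assoc, hX.fst_left, mul_assoc]
  · rw [mul_assoc, hY.snd_left, ← mul_assoc, hX.snd_left, mul_assoc]

theorem IsRaising.isEven_mul (hX : IsLowering S U X) (hY : IsRaising S U Y) :
    IsEven S (Y * X) := by
  rw [IsEven, fstLeg_mul, sndLeg_mul]
  constructor
  · rw [mul_assoc, ← hX.fst_right, ← mul_assoc, ← hY.fst_right, mul_assoc]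
  · rw [mul_assoc, ← hX.snd_right, ← mul_assoc, ← hY.snd_right, mul_assoc]

variable (br S U X Y) in
/-- The double brackets of the doubled cyclic quiver (normalized without halves). -/
structure IsCyclicPair : Prop where
  flip_S : flip S = S
  lowering : IsLowering S U X
  raising : IsRaising S U Y
  xx : dbl br X X = ι₁ X * S * ι₁ X - ι₂ X * S * ι₂ X
  yy : dbl br Y Y = ι₂ Y * S * ι₂ Y - ι₁ Y * S * ι₁ Y
  xy : dbl br X Y = U + U + U * ι₁ Y * ι₁ X + U * ι₂ X * ι₂ Y - S * ι₁ X * ι₂ Y + ι₁ Y * ι₂ X * S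

theorem IsCyclicPair.yx (h : IsCyclicPair br S U X Y) :
    dbl br Y X = -(flip U + flip U + flip U * ι₂ Y * ι₂ X + flip U * ι₁ X * ι₁ Y - S * ι₂ X * ι₁ Y
      + ι₂ Y * ι₁ X * S) := by
  rw [dbl_swap, h.xy]
  simp [h.flip_S]

/-- The moment map of the doubled cyclic quiver. -/
theorem IsCyclicPair.moment_X (h : IsCyclicPair br S U X Y) {K : Matrix I I B}
    (hK : (1 + Y * X) * K = 1) : IsMomentFor br S ((1 + X * Y) * K) X := by
  have eH : IsEven S (1 + Y * X) := IsEven.one.add (IsRaising.isEven_mul h.lowering h.raising)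
  have eG : IsEven S (1 + X * Y) := IsEven.one.add (IsLowering.isEven_mul h.lowering h.raising)
  have eK := eH.inv hK
  have hK' := mul_eq_one_comm.mp hK
  have dG : dbl br (1 + X * Y) X = ι₁ X * (S * (ι₁ (1 + X * Y) - ι₂ (1 + X * Y)))
      - S * (ι₁ (1 + X * Y) + ι₂ (1 + X * Y)) * ι₂ X := by
    rw [dbl_add_left, dbl_one_left, dbl_mul_left, h.xx, h.yx]
    simp only [mul_add, mul_sub, mul_neg, add_mul, sub_mul, mul_assoc, fstLeg_mul,
      sndLeg_mul, fstLeg_add, sndLeg_add, fstLeg_one, sndLeg_one, mul_one,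
      sndLeg_mul_fstLeg, sndLeg_mul_fstLeg_assoc, h.lowering.snd_left,
      mul_eq_mul_assoc h.lowering.snd_left, h.raising.snd_left]
    abel
  have dH : dbl br (1 + Y * X) X = S * (ι₁ (1 + Y * X) - ι₂ (1 + Y * X)) * ι₂ X
      - ι₁ X * (S * (ι₁ (1 + Y * X) + ι₂ (1 + Y * X))) := by
    rw [dbl_add_left, dbl_one_left, dbl_mul_left, h.xx, h.yx]
    simp only [mul_add, mul_sub, neg_mul, add_mul, sub_mul, mul_assoc, fstLeg_mul,
      sndLeg_mul, fstLeg_add, sndLeg_add, fstLeg_one, sndLeg_one, mul_one,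
      sndLeg_mul_fstLeg, sndLeg_mul_fstLeg_assoc, h.lowering.fst_right,
      mul_eq_mul_assoc h.lowering.fst_right, mul_eq_mul_assoc h.lowering.snd_right.symm,
      mul_eq_mul_assoc h.raising.snd_right.symm]
    abel
  have dK : dbl br K X = S * (ι₁ K - ι₂ K) * ι₂ X + ι₁ X * (S * (ι₁ K + ι₂ K)) := by
    rw [dbl_inv_left br hK, dH]
    simp only [mul_add, mul_sub, add_mul, sub_mul, mul_assoc, mul_eq_mul_assoc eK.2,
      sndLeg_mul_fstLeg, sndLeg_mul_fstLeg_assoc, mul_one,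
      mul_eq_one_assoc (fstLeg_mul_fstLeg_of hK), sndLeg_mul_sndLeg_of hK',
      mul_eq_one_assoc (sndLeg_mul_sndLeg_of hK')]
    abel
  -- `G` and `K` each satisfy the moment condition up to the sign of some terms. In the product the
  -- terms mixing `ι₂ G` and `ι₁ K` cancel.
  generalize 1 + X * Y = G at *
  unfold IsMomentFor
  rw [dbl_mul_left, dG, dK]
  simp only [mul_add, mul_sub, add_mul, sub_mul, mul_assoc, fstLeg_mul, sndLeg_mul,
    sndLeg_mul_fstLeg, sndLeg_mul_fstLeg_assoc, mul_eq_mul_assoc eG.2]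
  abel

theorem IsCyclicPair.moment_Y (h : IsCyclicPair br S U X Y) {K : Matrix I I B}
    (hK : (1 + Y * X) * K = 1) : IsMomentFor br S ((1 + X * Y) * K) Y := by
  have eH : IsEven S (1 + Y * X) := IsEven.one.add (IsRaising.isEven_mul h.lowering h.raising)
  have eG : IsEven S (1 + X * Y) := IsEven.one.add (IsLowering.isEven_mul h.lowering h.raising)
  have eK := eH.inv hK
  have hK' := mul_eq_one_comm.mp hK
  have dG : dbl br (1 + X * Y) Y = ι₁ Y * (S * (ι₁ (1 + X * Y) + ι₂ (1 + X * Y)))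
      - S * (ι₁ (1 + X * Y) - ι₂ (1 + X * Y)) * ι₂ Y := by
    rw [dbl_add_left, dbl_one_left, dbl_mul_left, h.yy, h.xy]
    simp only [mul_add, mul_sub, add_mul, sub_mul, mul_assoc, fstLeg_mul,
      sndLeg_mul, fstLeg_add, sndLeg_add, fstLeg_one, sndLeg_one, mul_one,
      sndLeg_mul_fstLeg, sndLeg_mul_fstLeg_assoc, h.raising.fst_left.symm,
      mul_eq_mul_assoc h.raising.fst_left.symm, mul_eq_mul_assoc h.raising.snd_left,
      mul_eq_mul_assoc h.lowering.snd_left]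
    abel
  have dH : dbl br (1 + Y * X) Y = S * (ι₁ (1 + Y * X) + ι₂ (1 + Y * X)) * ι₂ Y
      - ι₁ Y * (S * (ι₁ (1 + Y * X) - ι₂ (1 + Y * X))) := by
    rw [dbl_add_left, dbl_one_left, dbl_mul_left, h.yy, h.xy]
    simp only [mul_add, mul_sub, add_mul, sub_mul, mul_assoc, fstLeg_mul,
      sndLeg_mul, fstLeg_add, sndLeg_add, fstLeg_one, sndLeg_one, mul_one,
      sndLeg_mul_fstLeg, sndLeg_mul_fstLeg_assoc, h.raising.snd_right.symm,
      mul_eq_mul_assoc h.raising.snd_right.symm, h.lowering.snd_right.symm]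
    abel
  have dK : dbl br K Y = ι₁ Y * (S * (ι₂ K - ι₁ K)) - S * (ι₁ K + ι₂ K) * ι₂ Y := by
    rw [dbl_inv_left br hK, dH]
    simp only [mul_add, mul_sub, add_mul, sub_mul, mul_assoc, mul_eq_mul_assoc eK.2,
      sndLeg_mul_fstLeg, sndLeg_mul_fstLeg_assoc, mul_one,
      mul_eq_one_assoc (fstLeg_mul_fstLeg_of hK), sndLeg_mul_sndLeg_of hK',
      mul_eq_one_assoc (sndLeg_mul_sndLeg_of hK')]
    abel
  generalize 1 + X * Y = G at *
  unfold IsMomentFor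
  rw [dbl_mul_left, dG, dK]
  simp only [mul_add, mul_sub, add_mul, sub_mul, mul_assoc, fstLeg_mul, sndLeg_mul,
    sndLeg_mul_fstLeg, sndLeg_mul_fstLeg_assoc, mul_eq_mul_assoc eG.2]
  abel

theorem IsRaising.add {Y' : Matrix I I B} (hY : IsRaising S U Y) (hY' : IsRaising S U Y') :
    IsRaising S U (Y + Y') := by
  constructor <;> simp only [fstLeg_add, sndLeg_add, mul_add, add_mul]
  · rw [hY.fst_left, hY'.fst_left]
  · rw [hY.fst_right, hY'.fst_right]
  · rw [hY.snd_left, hY'.snd_left]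
  · rw [hY.snd_right, hY'.snd_right]

theorem IsLowering.inv {K : Matrix I I B} (hX : IsLowering S U X) (hK : X * K = 1) :
    IsRaising S U K := by
  have h1 := fstLeg_mul_fstLeg_of hK
  have h2 := sndLeg_mul_sndLeg_of hK
  have h1' := fstLeg_mul_fstLeg_of (mul_eq_one_comm.mp hK)
  have h2' := sndLeg_mul_sndLeg_of (mul_eq_one_comm.mp hK)
  constructor
  · calc ι₁ K * S = ι₁ K * (S * ι₁ X) * ι₁ K := by rw [mul_assoc, mul_assoc, h1, mul_one]
      _ = _ := by rw [← hX.fst_left, ← mul_assoc, h1', one_mul]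
  · calc S * ι₁ K = ι₁ K * (ι₁ X * S) * ι₁ K := by rw [← mul_assoc (ι₁ K), h1', one_mul]
      _ = _ := by rw [← hX.fst_right, mul_assoc, mul_assoc, h1, mul_one]
  · calc ι₂ K * S = ι₂ K * (S * ι₂ X) * ι₂ K := by rw [mul_assoc, mul_assoc, h2, mul_one]
      _ = _ := by rw [← hX.snd_left, ← mul_assoc, h2', one_mul]
  · calc S * ι₂ K = ι₂ K * (ι₂ X * S) * ι₂ K := by rw [← mul_assoc (ι₂ K), h2', one_mul]
      _ = _ := by rw [← hX.snd_right, mul_assoc, mul_assoc, h2, mul_one]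

/-- `Z = Y + X⁻¹` satisfies the same quadratic relation as `Y`. -/
theorem IsCyclicPair.zz (h : IsCyclicPair br S U X Y) {K : Matrix I I B} (hK : X * K = 1) :
    dbl br (Y + K) (Y + K)
      = ι₂ (Y + K) * S * ι₂ (Y + K) - ι₁ (Y + K) * S * ι₁ (Y + K) := by
  have h1 := fstLeg_mul_fstLeg_of hK
  have h2 := sndLeg_mul_sndLeg_of hK
  have h1' := fstLeg_mul_fstLeg_of (mul_eq_one_comm.mp hK)
  have h2' := sndLeg_mul_sndLeg_of (mul_eq_one_comm.mp hK)
  have r := h.lowering.inv hK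
  have kk : dbl br K K = ι₂ K * S * ι₂ K - ι₁ K * S * ι₁ K := by
    rw [dbl_inv_left br hK, dbl_inv_right br hK, h.xx]
    simp only [mul_sub, mul_neg, neg_mul, sub_mul, mul_assoc, sndLeg_mul_fstLeg,
      sndLeg_mul_fstLeg_assoc, h2, mul_one, mul_eq_one_assoc h1,
      mul_eq_one_assoc h1', mul_eq_one_assoc h2']
    abel
  have ky : dbl br K Y = -(S * (ι₁ K * ι₂ K) + S * (ι₁ K * ι₂ K) + S * (ι₁ Y * ι₂ K)
      + S * (ι₁ K * ι₂ Y) - ι₂ K * (S * ι₂ Y) + ι₁ Y * (S * ι₁ K)) := by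
    rw [dbl_inv_left br hK, h.xy]
    simp only [mul_add, mul_sub, add_mul, sub_mul, mul_assoc, sndLeg_mul_fstLeg,
      sndLeg_mul_fstLeg_assoc, mul_eq_one_assoc h1, mul_eq_one_assoc h2',
      mul_eq_mul_assoc h.lowering.snd_right, mul_eq_mul_assoc r.snd_right.symm]
  have yk : dbl br Y K = S * (ι₁ K * ι₂ K) + S * (ι₁ K * ι₂ K) + S * (ι₁ K * ι₂ Y)
      + S * (ι₁ Y * ι₂ K) - ι₁ K * (S * ι₁ Y) + ι₂ Y * (S * ι₂ K) := by
    rw [dbl_swap, ky]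
    simp [h.flip_S, sndLeg_mul_fstLeg]
  -- In `ky + yk` all terms with one factor in each leg cancel, including those from the constant
  -- part of `dbl br X Y`. The rest are the cross terms of the quadratic expression in `Y + K`.
  rw [dbl_add_left, dbl_add_right, dbl_add_right, h.yy, kk, ky, yk]
  simp only [fstLeg_add, sndLeg_add, mul_add, add_mul, mul_assoc]
  abel

end Cyclic

/-! ### Contraction of legs and brackets with traces. -/

section TraceBracket

variable {B : Type*} [CommRing B] [Algebra ℂ B] {I : Type*} [Fintype I] [DecidableEq I]

/-- The contraction sending `P ⊗ Q` to `Q * P`. -/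
def contract (M : Matrix (I × I) (I × I) B) : Matrix I I B :=
  of fun i j => ∑ k, M (k, i) (j, k)

theorem contract_add (M N : Matrix (I × I) (I × I) B) :
    contract (M + N) = contract M + contract N := by
  ext i j
  simp [contract, Finset.sum_add_distrib]

theorem contract_neg (M : Matrix (I × I) (I × I) B) : contract (-M) = -contract M := by
  ext i j
  simp [contract]

theorem contract_sub (M N : Matrix (I × I) (I × I) B) :
    contract (M - N) = contract M - contract N := by
  rw [sub_eq_add_neg, contract_add, contract_neg, sub_eq_add_neg]

/-- Both sides send `P ⊗ Q` to `Q * C * P`. This is why contraction kills inner double derivations.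
-/
theorem contract_fstLeg_mul (C : Matrix I I B) (M : Matrix (I × I) (I × I) B) :
    contract (ι₁ C * M) = contract (M * ι₂ C) := by
  ext i j
  simp only [contract, of_apply, mul_apply, fstLeg, sndLeg, Fintype.sum_prod_type, kronecker_apply,
    one_apply, mul_ite, mul_one, mul_zero, ite_mul, zero_mul, one_mul, Finset.sum_ite_eq,
    Finset.sum_ite_eq', Finset.mem_univ, if_true, Finset.sum_ite_irrel, Finset.sum_const_zero]
  rw [Finset.sum_comm]
  simp only [mul_comm]

theorem contract_sndLeg_mul (C : Matrix I I B) (M : Matrix (I × I) (I × I) B) :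
    contract (ι₂ C * M) = C * contract M := by
  ext i j
  simp only [contract, of_apply, mul_apply, sndLeg, Fintype.sum_prod_type, kronecker_apply,
    one_apply, ite_mul, one_mul, zero_mul, Finset.sum_ite_irrel, Finset.sum_const_zero,
    Finset.sum_ite_eq, Finset.mem_univ, if_true, Finset.mul_sum]
  rw [Finset.sum_comm]

variable {br : SkewBiderivation B} {S U : Matrix (I × I) (I × I) B}

theorem contract_dbl (A C : Matrix I I B) (i j : I) :
    contract (dbl br A C) i j = br.ham (A i j) C.trace := by
  simp [contract, dbl, trace]

/-- By cyclicity the `k + 1` Leibniz terms have the same contraction. The spare factor `C ^ j` lets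
the induction absorb the power moved across. -/
theorem contract_dbl_pow (A C : Matrix I I B) (k j : ℕ) :
    contract (dbl br A (C ^ (k + 1)) * ι₂ (C ^ j))
      = (k + 1) • contract (dbl br A C * ι₂ (C ^ (k + j))) := by
  induction k generalizing j with
  | zero => simp
  | succ k ih =>
    rw [pow_succ' C (k + 1), dbl_mul_right, add_mul, contract_add, mul_assoc, contract_fstLeg_mul,
      mul_assoc, mul_assoc, ← sndLeg_mul, ← sndLeg_mul, ← pow_succ, ← pow_add, ih, succ_nsmul _ (k + 1),
      show k + 1 + j = k + (j + 1) by ring]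

theorem IsMomentFor.ham_trace {Φ C : Matrix I I B} (h : IsMomentFor br S Φ C) (i j : I) :
    br.ham (Φ i j) C.trace = 0 := by
  rw [← contract_dbl, h, contract_sub, contract_fstLeg_mul, sub_self, Matrix.zero_apply]

theorem IsMomentFor.pow {Φ C : Matrix I I B} (h : IsMomentFor br S Φ C) (k : ℕ) :
    IsMomentFor br S Φ (C ^ k) := by
  induction k with
  | zero => simpa using IsMomentFor.one Φ
  | succ k ih => rw [pow_succ]; exact ih.mul h

/-- Although `L` does not have degree zero, `L ⊗ L` shifts both vertices by one and so commutes with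
`S`. -/
theorem contract_shift {L : Matrix I I B} (hL : IsRaising S U L) (A : Matrix I I B) :
    contract (S * ι₁ L * ι₂ L * ι₂ A) = L * contract (S * ι₂ (A * L)) := by
  have e : S * ι₁ L * ι₂ L * ι₂ A = ι₂ L * (ι₁ L * (S * ι₂ A)) := by
    simp only [mul_assoc, mul_eq_mul_assoc hL.fst_left, ← sndLeg_mul_fstLeg_assoc]
    simp only [sndLeg_mul_fstLeg_assoc, mul_eq_mul_assoc hL.snd_right.symm]
  rw [e, contract_sndLeg_mul, contract_fstLeg_mul, mul_assoc, sndLeg_mul]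

/-- The entries of `L` Poisson commute with the traces of powers of `Φ * L`. -/
theorem ham_trace_pow_eq_zero (hS : flip S = S) {L Φ : Matrix I I B} (hL : IsRaising S U L)
    (hLL : dbl br L L = ι₂ L * S * ι₂ L - ι₁ L * S * ι₁ L) (eΦ : IsEven S Φ)
    (hΦ : IsMomentFor br S Φ L) (i j : I) (k : ℕ) :
    br.ham (L i j) ((Φ * L) ^ k).trace = 0 := by
  rcases k with _ | k
  · rw [← contract_dbl, pow_zero, dbl_one_right]
    simp [contract]
  have d : dbl br L (Φ * L) = -(ι₁ (Φ * L) * (S * ι₁ L)) + ι₁ Φ * (S * ι₁ L * ι₂ L)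
      + S * ι₁ L * ι₂ (Φ * L) - ι₂ L * (S * ι₂ (Φ * L)) := by
    have a : dbl br L Φ = S * (ι₁ Φ + ι₂ Φ) * ι₁ L - ι₂ L * (S * (ι₁ Φ + ι₂ Φ)) := by
      unfold IsMomentFor at hΦ
      rw [dbl_swap, hΦ]
      simp only [map_sub, map_add, map_mul, hS, flip_fstLeg, flip_sndLeg, add_comm (ι₂ Φ)]
      abel
    rw [dbl_mul_right, hLL, a]
    simp only [mul_add, mul_sub, add_mul, sub_mul, mul_assoc, fstLeg_mul, sndLeg_mul,
      sndLeg_mul_fstLeg, sndLeg_mul_fstLeg_assoc, mul_eq_mul_assoc eΦ.1.symm]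
    abel
  have e := contract_dbl_pow (br := br) L (Φ * L) k 0
  rw [pow_zero, sndLeg_one, mul_one] at e
  rw [← contract_dbl, e, add_zero, d]
  -- After contraction the four terms cancel in pairs: first with third by cyclicity, second with
  -- fourth by `contract_shift`.
  have z : contract ((-(ι₁ (Φ * L) * (S * ι₁ L)) + ι₁ Φ * (S * ι₁ L * ι₂ L)
      + S * ι₁ L * ι₂ (Φ * L) - ι₂ L * (S * ι₂ (Φ * L))) * ι₂ ((Φ * L) ^ k)) = 0 := by
    generalize hu : Φ * L = u
    have c₁ : contract (ι₁ u * (S * ι₁ L) * ι₂ (u ^ k)) = contract (S * ι₁ L * ι₂ (u ^ (k + 1))) := by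
      rw [mul_assoc, contract_fstLeg_mul, mul_assoc _ (ι₂ _), ← sndLeg_mul, ← pow_succ]
    have c₂ : contract (ι₁ Φ * (S * ι₁ L * ι₂ L) * ι₂ (u ^ k))
        = L * contract (S * ι₂ (u ^ (k + 1))) := by
      rw [mul_assoc, contract_fstLeg_mul, mul_assoc _ (ι₂ _), ← sndLeg_mul, contract_shift hL,
        mul_assoc _ Φ, hu, ← pow_succ]
    have c₃ : S * ι₁ L * ι₂ u * ι₂ (u ^ k) = S * ι₁ L * ι₂ (u ^ (k + 1)) := by
      rw [mul_assoc _ (ι₂ u), ← sndLeg_mul, ← pow_succ']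
    have c₄ : contract (ι₂ L * (S * ι₂ u) * ι₂ (u ^ k)) = L * contract (S * ι₂ (u ^ (k + 1))) := by
      rw [mul_assoc, contract_sndLeg_mul, mul_assoc, ← sndLeg_mul, ← pow_succ']
    rw [sub_mul, add_mul, add_mul, contract_sub, contract_add, contract_add, neg_mul, contract_neg,
      c₁, c₂, c₃, c₄]
    abel
  rw [z]
  simp

theorem derivation_mul_apply {D : Derivation ℂ B B} {A C : Matrix I I B}
    (hA : ∀ i j, D (A i j) = 0) (hC : ∀ i j, D (C i j) = 0) (i j : I) : D ((A * C) i j) = 0 := by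
  simp [mul_apply, hA, hC]

theorem derivation_trace_pow {D : Derivation ℂ B B} {A : Matrix I I B}
    (hA : ∀ i j, D (A i j) = 0) (k : ℕ) : D (A ^ k).trace = 0 := by
  have h : ∀ i j, D ((A ^ k) i j) = 0 := by
    induction k with
    | zero => intro i j; by_cases h : i = j <;> simp [one_apply, h]
    | succ k ih => rw [pow_succ]; exact derivation_mul_apply ih hA
  simp [trace, h]

end TraceBracket

/-! ### The chain of partial moment maps and commutation of traces. -/

section Chain

variable {B : Type*} [CommRing B] [Algebra ℂ B] {I : Type*} [Fintype I] [DecidableEq I]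

/-- The data attached to the framed cyclic quiver: the pair `(X, Y)`, an inverse `K` of `1 + Y X`,
the factors `g c = 1 + W_c V_c` with inverses `k c`, and the partial moment maps `Φ b`. -/
structure FramedCyclic (br : SkewBiderivation B) (S U : Matrix (I × I) (I × I) B)
    (X Y K : Matrix I I B) {N : ℕ} (g k : Fin N → Matrix I I B)
    (Φ : Fin (N + 1) → Matrix I I B) : Prop where
  pair : IsCyclicPair br S U X Y
  inv_K : (1 + Y * X) * K = 1
  inv_g : ∀ c, g c * k c = 1
  even_g : ∀ c, IsEven S (g c)
  X_prec : ∀ c, Precedes br S X (g c)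
  Y_prec : ∀ c, Precedes br S Y (g c)
  g_prec : ∀ c c', c < c' → Precedes br S (g c) (g c')
  g_self : ∀ c, dbl br (g c) (g c) = S * (ι₂ (g c) * ι₂ (g c)) - S * (ι₁ (g c) * ι₁ (g c))
  Φ_zero : Φ 0 = (1 + X * Y) * K
  Φ_succ : ∀ c : Fin N, Φ c.succ = Φ c.castSucc * k c

namespace FramedCyclic

variable {br : SkewBiderivation B} {S U : Matrix (I × I) (I × I) B} {X Y K : Matrix I I B} {N : ℕ}
  {g k : Fin N → Matrix I I B} {Φ : Fin (N + 1) → Matrix I I B}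

theorem even (h : FramedCyclic br S U X Y K g k Φ) (b : Fin (N + 1)) : IsEven S (Φ b) := by
  induction b using Fin.induction with
  | zero =>
    rw [h.Φ_zero]
    exact (IsEven.one.add (IsLowering.isEven_mul h.pair.lowering h.pair.raising)).mul
      ((IsEven.one.add (IsRaising.isEven_mul h.pair.lowering h.pair.raising)).inv h.inv_K)
  | succ c ih =>
    rw [h.Φ_succ]
    exact ih.mul ((h.even_g c).inv (h.inv_g c))

/-- Counting from zero, `Φ b` contains only the factors `g a` with `a < b`, and these all precede `g
c` when `b ≤ c`. -/
theorem prec (h : FramedCyclic br S U X Y K g k Φ) (b : Fin (N + 1)) (c : Fin N)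
    (hbc : (b : ℕ) ≤ c) : Precedes br S (Φ b) (g c) := by
  induction b using Fin.induction with
  | zero =>
    rw [h.Φ_zero]
    exact ((Precedes.one _).add ((h.X_prec c).mul (h.Y_prec c))).mul
      (((Precedes.one _).add ((h.Y_prec c).mul (h.X_prec c))).inv h.inv_K)
  | succ a ih =>
    rw [h.Φ_succ]
    have hac : a < c := hbc
    exact (ih hac.le).mul ((h.g_prec a c hac).inv (h.inv_g a))

theorem moment_of_prec (h : FramedCyclic br S U X Y K g k Φ) {x : Matrix I I B}
    (h0 : IsMomentFor br S (Φ 0) x) (hx : ∀ c, Precedes br S x (g c)) (b : Fin (N + 1)) :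
    IsMomentFor br S (Φ b) x := by
  induction b using Fin.induction with
  | zero => exact h0
  | succ a ih =>
    rw [h.Φ_succ]
    exact ih.mul_inv_of_precedes h.pair.flip_S (hx a) (h.even _) (h.even_g a) (h.inv_g a)

theorem moment_X (h : FramedCyclic br S U X Y K g k Φ) (b : Fin (N + 1)) :
    IsMomentFor br S (Φ b) X :=
  h.moment_of_prec (h.Φ_zero ▸ h.pair.moment_X h.inv_K) h.X_prec b

theorem moment_Y (h : FramedCyclic br S U X Y K g k Φ) (b : Fin (N + 1)) :
    IsMomentFor br S (Φ b) Y :=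
  h.moment_of_prec (h.Φ_zero ▸ h.pair.moment_Y h.inv_K) h.Y_prec b

/-- The factor `g c` enters at `b = c + 1`, where `IsMomentFor.mul_inv_self` applies; later factors
are handled by fusion. -/
theorem moment_g (h : FramedCyclic br S U X Y K g k Φ) (b : Fin (N + 1)) (c : Fin N)
    (hcb : (c : ℕ) < b) : IsMomentFor br S (Φ b) (g c) := by
  induction b using Fin.induction with
  | zero => simp at hcb
  | succ a ih =>
    rw [h.Φ_succ]
    rcases (show c ≤ a from Nat.lt_succ_iff.mp hcb).lt_or_eq with hlt | rfl
    · exact (ih hlt).mul_inv_of_precedes h.pair.flip_S (h.g_prec c a hlt)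
        (h.even _) (h.even_g a) (h.inv_g a)
    · exact IsMomentFor.mul_inv_self (h.prec _ _ le_rfl) (h.g_self c) (h.even _) (h.even_g c)
        (h.inv_g c)

theorem moment_Φ (h : FramedCyclic br S U X Y K g k Φ) (b c : Fin (N + 1)) (hbc : b ≤ c) :
    IsMomentFor br S (Φ c) (Φ b) := by
  induction b using Fin.induction with
  | zero =>
    rw [h.Φ_zero]
    exact ((IsMomentFor.one _).add ((h.moment_X c).mul (h.moment_Y c))).mul
      (((IsMomentFor.one _).add ((h.moment_Y c).mul (h.moment_X c))).inv h.inv_K)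
  | succ a ih =>
    rw [h.Φ_succ]
    have hac : (a : ℕ) < c := hbc
    exact (ih (Fin.le_def.mpr hac.le)).mul ((h.moment_g c a hac).inv (h.inv_g a))

/-- The traces of powers of the matrices `Φ b * L` Poisson commute. -/
theorem ham_trace_trace (h : FramedCyclic br S U X Y K g k Φ) {L : Matrix I I B}
    (hL : IsRaising S U L) (hLL : dbl br L L = ι₂ L * S * ι₂ L - ι₁ L * S * ι₁ L)
    (hm : ∀ b, IsMomentFor br S (Φ b) L) (b c : Fin (N + 1)) (p q : ℕ) :
    br.ham ((Φ b * L) ^ p).trace ((Φ c * L) ^ q).trace = 0 := by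
  wlog hbc : b ≤ c generalizing b c p q
  · rw [br.skew, this c b q p (le_of_not_ge hbc), neg_zero]
  refine derivation_trace_pow (derivation_mul_apply (fun i j => ?_) fun i j => ?_) q
  · rw [br.skew, (((h.moment_Φ b c hbc).mul (hm c)).pow p).ham_trace, neg_zero]
  · rw [br.skew, ham_trace_pow_eq_zero h.pair.flip_S hL hLL (h.even b) (hm b), neg_zero]

theorem ham_trace_trace_Y (h : FramedCyclic br S U X Y K g k Φ) (b c : Fin (N + 1)) (p q : ℕ) :
    br.ham ((Φ b * Y) ^ p).trace ((Φ c * Y) ^ q).trace = 0 :=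
  h.ham_trace_trace h.pair.raising h.pair.yy h.moment_Y b c p q

theorem ham_trace_trace_Z (h : FramedCyclic br S U X Y K g k Φ) {X' : Matrix I I B}
    (hX' : X * X' = 1) (b c : Fin (N + 1)) (p q : ℕ) :
    br.ham ((Φ b * (Y + X')) ^ p).trace ((Φ c * (Y + X')) ^ q).trace = 0 :=
  h.ham_trace_trace (h.pair.raising.add (h.pair.lowering.inv hX')) (h.pair.zz hX')
    (fun b => (h.moment_Y b).add ((h.moment_X b).inv hX')) b c p q

end FramedCyclic
end Chain

/-! ### Skewness of the quasi-Poisson bracket, and algebras of commuting functions. -/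

section QuasiPoisson

variable {m n : ℕ} {d : Fin m → ℕ} (f : PolyRing m n d)

theorem derivation_ext_coord {D D' : Derivation ℂ (RegFun f) (RegFun f)}
    (h : ∀ c, D (coord f c) = D' (coord f c)) : D = D' := by
  have hp : ∀ q : PolyRing m n d, D (algebraMap _ (RegFun f) q) = D' (algebraMap _ (RegFun f) q) := by
    intro q
    induction q using MvPolynomial.induction_on with
    | C a =>
      have : algebraMap (PolyRing m n d) (RegFun f) (MvPolynomial.C a) = algebraMap ℂ (RegFun f) a := by
        rw [IsScalarTower.algebraMap_apply ℂ (PolyRing m n d) (RegFun f)]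
        rfl
      rw [this, Derivation.map_algebraMap, Derivation.map_algebraMap]
    | add p q hp hq => simp only [map_add, hp, hq]
    | mul_X p c hp =>
      have hc := h c
      rw [coord] at hc
      simp only [map_mul, Derivation.leibniz, hp, hc]
  ext F
  obtain ⟨⟨q, s⟩, hF⟩ := IsLocalization.surj (Submonoid.powers f) F
  have e1 := congrArg D hF
  have e2 := congrArg D' hF
  rw [Derivation.leibniz] at e1 e2
  have hu : IsUnit (algebraMap (PolyRing m n d) (RegFun f) s) := IsLocalization.map_units _ s
  -- The Leibniz rule applied to `F * s = q`, with `s` a unit, determines the value at `F` from the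
  -- values at the polynomials `q` and `s`.
  apply hu.mul_left_cancel
  simp only [hp, smul_eq_mul] at e1 e2
  exact add_left_cancel (e1.trans e2.symm)

theorem vectorField_add (u v : Coord m n d → RegFun f) :
    vectorField f (u + v) = vectorField f u + vectorField f v :=
  derivation_ext_coord f fun c => by simp [vectorField_coord]

theorem vectorField_smul (a : RegFun f) (u : Coord m n d → RegFun f) :
    vectorField f (a • u) = a • vectorField f u :=
  derivation_ext_coord f fun c => by simp [vectorField_coord]

variable [NeZero m]

/-- Rewrites the term with `s = r - 1` in the form of the term with `r = s + 1`, so that the two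
halves of the `X X` and `Y Y` brackets can be compared. -/
theorem kd_sub_one_mul {B : Type} [CommRing B] (r s : Fin m) (F : Fin m → Fin m → B) :
    kd (s = r - 1) * F (r - 1) r = kd (r = s + 1) * F s (s + 1) := by
  by_cases h : r = s + 1
  · subst h
    simp [kd]
  · have h' : ¬ s = r - 1 := fun e => h (by rw [e, sub_add_cancel])
    simp [kd, h, h']

theorem coordBracket_skew {B : Type} [CommRing B] [Algebra ℂ B] (p : Coord m n d → B)
    (a b : Coord m n d) : coordBracket p a b = -coordBracket p b a := by
  have ho : ∀ {α : Type} [LinearOrder α] (x y : α), (ordSign x y : B) = -ordSign y x := by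
    intro α _ x y
    unfold ordSign
    rcases lt_trichotomy x y with h | rfl | h
    · simp [h, h.not_gt]
    · simp
    · simp [h, h.not_gt]
  have hsp : ∀ x y : Spin d, (spinSign x y : B) = -spinSign y x := by
    intro x y
    unfold spinSign
    rw [ho, mul_neg]
    congr 2
    simp [kd, eq_comm]
  rcases a with ⟨r, i, j⟩ | ⟨r, i, j⟩ | ⟨a, j⟩ | ⟨a, j⟩ <;>
    rcases b with ⟨s, k, l⟩ | ⟨s, k, l⟩ | ⟨b, l⟩ | ⟨b, l⟩ <;>
    simp only [coordBracket, neg_neg]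
  · simp only [brXX, kd_sub_one_mul r s fun a b => (matX p a * matX p b) k j,
      kd_sub_one_mul s r fun a b => (matX p a * matX p b) i l, Algebra.smul_def]
    ring
  · simp only [brYY, mul_right_comm _ (kd _) ((_ * _ : Matrix _ _ _) _ _),
      kd_sub_one_mul r s fun a b => (matY p b * matY p a) i l,
      kd_sub_one_mul s r fun a b => (matY p b * matY p a) k j, Algebra.smul_def]
    ring
  · simp only [brVV, ho a.1 b.1, hsp a b, Algebra.smul_def]
    ring
  · simp only [brWW, ho a.1 b.1, hsp a b, Algebra.smul_def]
    ring

/-- `bracket` is a derivation in its first argument by construction. Once it is shown to be one in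
the second as well, `{-, G}` and `-{G, -}` are derivations, and it suffices to compare them on
coordinates. -/
theorem bracket_skew (F G : RegFun f) : bracket f F G = -bracket f G F := by
  have h1 : ∀ c G, bracket f (coord f c) G = -bracket f G (coord f c) := by
    intro c G
    unfold bracket
    rw [vectorField_coord]
    have : vectorField f (fun c' => vectorField f (coordBracket (coord f) c') (coord f c))
        = -vectorField f (coordBracket (coord f) c) := by
      refine derivation_ext_coord f fun c' => ?_
      rw [vectorField_coord, vectorField_coord, Derivation.neg_apply, vectorField_coord,
        coordBracket_skew]
    rw [this, Derivation.neg_apply, neg_neg]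
  have h2 : ∀ G F F', bracket f G (F * F') = F * bracket f G F' + F' * bracket f G F := by
    intro G F F'
    unfold bracket
    have : (fun c => vectorField f (coordBracket (coord f) c) (F * F'))
        = F • (fun c => vectorField f (coordBracket (coord f) c) F')
          + F' • fun c => vectorField f (coordBracket (coord f) c) F := by
      ext c
      simp
    rw [this, vectorField_add, vectorField_smul, vectorField_smul]
    simp
  have h3 : ∀ G F F', bracket f G (F + F') = bracket f G F + bracket f G F' := by
    intro G F F'
    unfold bracket
    have : (fun c => vectorField f (coordBracket (coord f) c) (F + F'))
        = (fun c => vectorField f (coordBracket (coord f) c) F)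
          + fun c => vectorField f (coordBracket (coord f) c) F' := by
      ext c
      simp
    rw [this, vectorField_add]
    simp
  have h4 : ∀ G F (z : ℂ), bracket f G (z • F) = z • bracket f G F := by
    intro G F z
    have h0 : bracket f G (algebraMap ℂ _ z) = 0 := by
      unfold bracket
      have : (fun c => vectorField f (coordBracket (coord f) c) (algebraMap ℂ (RegFun f) z))
          = (0 : RegFun f) • (0 : Coord m n d → RegFun f) := by
        ext c
        simp
      rw [this, vectorField_smul]
      simp
    rw [Algebra.smul_def, h2, h0, mul_zero, add_zero, Algebra.smul_def]
  let D : Derivation ℂ (RegFun f) (RegFun f) :=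
    Derivation.mk' { toFun := fun F => -bracket f G F
                     map_add' := fun F F' => by rw [h3, neg_add]
                     map_smul' := fun z F => by rw [h4, smul_neg, RingHom.id_apply] } fun F F' => by
      simp only [LinearMap.coe_mk, AddHom.coe_mk, h2, smul_eq_mul]
      ring
  have hD : vectorField f (fun c => vectorField f (coordBracket (coord f) c) G) = D := by
    refine derivation_ext_coord f fun c => ?_
    have := h1 c G
    unfold bracket at this
    rw [vectorField_coord] at this
    rw [vectorField_coord]
    exact this
  exact DFunLike.congr_fun hD F

/-- Twice the quasi-Poisson bracket, as a skew-symmetric biderivation. -/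
noncomputable def quasiPoisson : SkewBiderivation (RegFun f) where
  -- The derivation available by construction is `{-, F}`; skewness turns its negative into `{F,
  -- -}`.
  ham F := -((2 : ℂ) • vectorField f fun c => vectorField f (coordBracket (coord f) c) F)
  skew F G := by
    change -((2 : ℂ) • bracket f G F) = - -((2 : ℂ) • bracket f F G)
    rw [bracket_skew f F G]
    simp

theorem quasiPoisson_ham (F G : RegFun f) :
    (quasiPoisson f).ham F G = (2 : ℂ) • bracket f F G := by
  change -((2 : ℂ) • bracket f G F) = _
  rw [bracket_skew f F G, smul_neg]

theorem quasiPoisson_ham_eq_zero {F G : RegFun f} (h : (quasiPoisson f).ham F G = 0) :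
    bracket f F G = 0 := by
  rw [quasiPoisson_ham] at h
  exact (smul_eq_zero.mp h).resolve_left two_ne_zero

/-- A subalgebra generated by pairwise Poisson commuting functions is an abelian Poisson algebra. -/
theorem isAbelianPoissonAlgebra_adjoin {T : Set (RegFun f)}
    (h : ∀ F ∈ T, ∀ G ∈ T, bracket f F G = 0) :
    IsAbelianPoissonAlgebra (bracket f) (Algebra.adjoin ℂ T) := by
  have key : ∀ G, (∀ F ∈ T, bracket f F G = 0) → ∀ F ∈ Algebra.adjoin ℂ T, bracket f F G = 0 := by
    intro G hG F hF
    exact Derivation.eqOn_adjoin (D1 := vectorField f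
      fun c => vectorField f (coordBracket (coord f) c) G) (D2 := 0) (s := T)
      (fun F hF => hG F hF) hF
  have ab : ∀ F ∈ Algebra.adjoin ℂ T, ∀ G ∈ Algebra.adjoin ℂ T, bracket f F G = 0 := by
    intro F hF G hG
    refine key G (fun F' hF' => ?_) F hF
    rw [bracket_skew, key F' (fun F'' hF'' => h F'' hF'' F' hF') G hG, neg_zero]
  refine ⟨fun F hF G hG => ?_, fun F hF G hG H hH => ?_, fun z F hF G hG => ?_, fun F _ G _ => ?_,
    fun F _ G _ H _ => ?_, fun F hF G hG H hH => ?_, ab⟩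
  · rw [ab F hF G hG]; exact zero_mem _
  · exact map_add (vectorField f _) F G
  · exact Derivation.map_smul (vectorField f _) z F
  · exact bracket_skew f F G
  · refine (Derivation.leibniz (vectorField f _) F G).trans ?_
    rw [smul_eq_mul, smul_eq_mul, mul_comm G]
    rfl
  · have z : ∀ F, bracket f F 0 = 0 := fun F => by
      rw [bracket_skew]
      exact neg_eq_zero.mpr (map_zero (vectorField f _))
    rw [ab G hG H hH, ab H hH F hF, ab F hF G hG, z, z, z]
    simp

end QuasiPoisson

/-! ### The vertex grading on the total space. -/

section Grading

variable {m n : ℕ} {B : Type} [CommRing B] [Algebra ℂ B]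

/-- `∑ e_r ⊗ e_r` for the idempotents `e_r` of the vertices. -/
def vertexDiag (n m : ℕ) (B : Type) [CommRing B] :
    Matrix ((Fin n × Fin m) × (Fin n × Fin m)) ((Fin n × Fin m) × (Fin n × Fin m)) B :=
  diagonal fun P => if P.1.2 = P.2.2 then 1 else 0

/-- `∑ e_{r+1} ⊗ e_r` for the idempotents `e_r` of the vertices. -/
def vertexShift (n m : ℕ) [NeZero m] (B : Type) [CommRing B] :
    Matrix ((Fin n × Fin m) × (Fin n × Fin m)) ((Fin n × Fin m) × (Fin n × Fin m)) B :=
  diagonal fun P => if P.1.2 = P.2.2 + 1 then 1 else 0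

theorem flip_vertexDiag : flip (vertexDiag n m B) = vertexDiag n m B := by
  ext P Q
  rw [flip_apply]
  simp only [vertexDiag, diagonal_apply, Prod.swap_inj, Prod.fst_swap, Prod.snd_swap]
  simp only [eq_comm]

theorem flip_vertexShift [NeZero m] : flip (vertexShift n m B)
    = diagonal fun P => if P.2.2 = P.1.2 + 1 then 1 else 0 := by
  ext P Q
  rw [flip_apply]
  simp only [vertexShift, diagonal_apply, Prod.swap_inj, Prod.fst_swap, Prod.snd_swap]

local notation "𝐒" => vertexDiag n m B
local notation "𝐔" => vertexShift n m B

variable [NeZero m]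

theorem isLowering_of_apply {A : Matrix (Fin n × Fin m) (Fin n × Fin m) B}
    (h : ∀ P Q, Q.2 ≠ P.2 + 1 → A P Q = 0) : IsLowering 𝐒 𝐔 A := by
  constructor <;> try rw [flip_vertexShift]
  all_goals
    ext ⟨⟨k, s⟩, ⟨i, r⟩⟩ ⟨⟨j, t⟩, ⟨l, u⟩⟩
    have h1 := h (k, s) (j, t)
    have h2 := h (i, r) (l, u)
    simp only [vertexDiag, vertexShift, mul_diagonal, diagonal_mul, fstLeg, sndLeg,
      kronecker_apply, one_apply]
    grind

theorem isRaising_of_apply {A : Matrix (Fin n × Fin m) (Fin n × Fin m) B}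
    (h : ∀ P Q, P.2 ≠ Q.2 + 1 → A P Q = 0) : IsRaising 𝐒 𝐔 A := by
  constructor <;> try rw [flip_vertexShift]
  all_goals
    ext ⟨⟨k, s⟩, ⟨i, r⟩⟩ ⟨⟨j, t⟩, ⟨l, u⟩⟩
    have h1 := h (k, s) (j, t)
    have h2 := h (i, r) (l, u)
    simp only [vertexDiag, vertexShift, mul_diagonal, diagonal_mul, fstLeg, sndLeg,
      kronecker_apply, one_apply]
    grind

end Grading

/-! ### Double brackets of `X` and `Y` from the coordinate brackets. -/

section Pair

variable {m n : ℕ} [NeZero m] {d : Fin m → ℕ} {B : Type} [CommRing B] [Algebra ℂ B]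
  {p : Coord m n d → B} {br : SkewBiderivation B}

local notation "𝐒" => vertexDiag n m B
local notation "𝐔" => vertexShift n m B

theorem two_smul_half (a : B) : (2 : ℂ) • (1 / 2 : ℂ) • a = a := by
  rw [smul_smul]
  norm_num

theorem cycX_apply_of_ne (P Q : Fin n × Fin m) (h : Q.2 ≠ P.2 + 1) : cycX p P Q = 0 := by
  simp [cycX, h]

theorem cycUp_apply_of_ne (L : Fin m → Matrix (Fin n) (Fin n) B) (P Q : Fin n × Fin m)
    (h : P.2 ≠ Q.2 + 1) : cycUp L P Q = 0 := by
  simp [cycUp, h]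

theorem fstLeg_apply {I : Type*} [DecidableEq I] (A : Matrix I I B) (k i j l : I) :
    ι₁ A (k, i) (j, l) = if i = l then A k j else 0 := by
  simp [fstLeg, one_apply]

theorem sndLeg_apply {I : Type*} [DecidableEq I] (A : Matrix I I B) (k i j l : I) :
    ι₂ A (k, i) (j, l) = if k = j then A i l else 0 := by
  simp [sndLeg, one_apply]

theorem fstLeg_mul_sndLeg_apply {I : Type*} [Fintype I] [DecidableEq I] (A C : Matrix I I B)
    (k i j l : I) : (ι₁ A * ι₂ C) (k, i) (j, l) = A k j * C i l := by
  simp [fstLeg, sndLeg, ← mul_kronecker_mul]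

theorem matX_apply (s : Fin m) (i j : Fin n) : matX p s i j = p (.x s i j) := rfl

theorem matY_apply (s : Fin m) (i j : Fin n) : matY p s i j = p (.y s i j) := rfl

theorem cycX_apply (k j : Fin n) (s t : Fin m) :
    cycX p (k, s) (j, t) = if t = s + 1 then p (.x s k j) else 0 := rfl

theorem cycY_apply (k j : Fin n) (s t : Fin m) :
    cycUp (matY p) (k, s) (j, t) = if s = t + 1 then p (.y t k j) else 0 := rfl

theorem cycX_mul_cycX_apply (k j : Fin n) (s t : Fin m) : (cycX p * cycX p) (k, s) (j, t)
    = if t = s + 1 + 1 then (matX p s * matX p (s + 1)) k j else 0 := by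
  simp only [mul_apply, cycX, Fintype.sum_prod_type, of_apply, ite_mul, zero_mul,
    Finset.sum_ite_eq', Finset.mem_univ, if_true]
  simp only [mul_ite, mul_zero, Finset.sum_ite_irrel, Finset.sum_const_zero]

theorem cycUp_mul_cycUp_apply (L : Fin m → Matrix (Fin n) (Fin n) B) (k j : Fin n) (s t : Fin m) :
    (cycUp L * cycUp L) (k, s) (j, t)
      = if s = t + 1 + 1 then (L (t + 1) * L t) k j else 0 := by
  simp [mul_apply, cycUp, Fintype.sum_prod_type]

theorem cycX_mul_cycUp (L : Fin m → Matrix (Fin n) (Fin n) B) :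
    cycX p * cycUp L = blockDiagonal fun s => matX p s * L s := by
  ext ⟨k, s⟩ ⟨j, t⟩
  simp only [mul_apply, cycX, cycUp, Fintype.sum_prod_type, of_apply, blockDiagonal_apply,
    ite_mul, zero_mul, Finset.sum_ite_eq', Finset.mem_univ, if_true, mul_ite, mul_zero,
    add_left_inj, Finset.sum_ite_irrel, Finset.sum_const_zero]
  by_cases h : s = t
  · simp [h]
  · simp [h, Ne.symm h]

theorem cycUp_mul_cycX (L : Fin m → Matrix (Fin n) (Fin n) B) :
    cycUp L * cycX p = blockDiagonal fun s => L (s - 1) * matX p (s - 1) := by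
  ext ⟨k, s⟩ ⟨j, t⟩
  have h : ∀ q : Fin m, s = q + 1 ↔ q = s - 1 := fun q => by rw [eq_sub_iff_add_eq, eq_comm]
  simp only [mul_apply, cycX, cycUp, Fintype.sum_prod_type, of_apply, blockDiagonal_apply, h,
    ite_mul, zero_mul, Finset.sum_ite_eq', Finset.mem_univ, if_true, sub_add_cancel]
  by_cases h : s = t
  · simp [h]
  · simp [h, Ne.symm h]

theorem ham_zero (br : SkewBiderivation B) (F : B) : br.ham 0 F = 0 := by
  rw [br.skew, map_zero, neg_zero]

theorem isLowering_cycX : IsLowering 𝐒 𝐔 (cycX p) := isLowering_of_apply cycX_apply_of_ne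

theorem isRaising_cycUp (L : Fin m → Matrix (Fin n) (Fin n) B) : IsRaising 𝐒 𝐔 (cycUp L) :=
  isRaising_of_apply (cycUp_apply_of_ne L)

theorem dbl_XX (hbr : ∀ a b, br.ham (p a) (p b) = (2 : ℂ) • coordBracket p a b) :
    dbl br (cycX p) (cycX p) = ι₁ (cycX p) * 𝐒 * ι₁ (cycX p) - ι₂ (cycX p) * 𝐒 * ι₂ (cycX p) := by
  -- Moving `S` past `X` turns it into a diagonal factor at the right end, so each side has explicit
  -- entries built from `X * X`.
  rw [mul_assoc, mul_assoc, ← isLowering_cycX.fst_left, ← isLowering_cycX.snd_left, ← mul_assoc,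
    ← mul_assoc, ← fstLeg_mul, ← sndLeg_mul, flip_vertexShift, vertexShift]
  ext ⟨⟨k, s⟩, ⟨i, r⟩⟩ ⟨⟨j, t⟩, ⟨l, u⟩⟩
  simp only [Matrix.sub_apply, mul_diagonal, fstLeg_apply, sndLeg_apply, cycX_mul_cycX_apply]
  simp only [cycX_apply, of_apply, dbl]
  by_cases ht : t = r + 1
  · by_cases hu : u = s + 1
    · simp only [ht, hu, if_true, hbr, coordBracket, brXX, smul_sub, two_smul_half,
        kd_sub_one_mul r s fun a b => (matX p a * matX p b) k j]
      simp only [kd, Prod.mk.injEq]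
      grind
    · simp only [hu, if_false, map_zero]
      grind
  · simp only [ht, if_false, ham_zero]
    grind

theorem dbl_YY (hbr : ∀ a b, br.ham (p a) (p b) = (2 : ℂ) • coordBracket p a b) :
    dbl br (cycUp (matY p)) (cycUp (matY p)) = ι₂ (cycUp (matY p)) * 𝐒 * ι₂ (cycUp (matY p))
      - ι₁ (cycUp (matY p)) * 𝐒 * ι₁ (cycUp (matY p)) := by
  have hY := isRaising_cycUp (matY p)
  rw [mul_assoc, mul_assoc, hY.snd_right, hY.fst_right, ← mul_assoc,
    ← mul_assoc, ← fstLeg_mul, ← sndLeg_mul, flip_vertexShift, vertexShift]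
  ext ⟨⟨k, s⟩, ⟨i, r⟩⟩ ⟨⟨j, t⟩, ⟨l, u⟩⟩
  simp only [Matrix.sub_apply, mul_diagonal, fstLeg_apply, sndLeg_apply, cycUp_mul_cycUp_apply]
  simp only [cycY_apply, of_apply, dbl]
  by_cases ht : r = t + 1
  · by_cases hu : s = u + 1
    · simp only [ht, hu, if_true, hbr, coordBracket, brYY, smul_sub, two_smul_half,
        mul_right_comm _ (kd _) ((_ * _ : Matrix _ _ _) _ _),
        kd_sub_one_mul t u fun a b => (matY p b * matY p a) i l]
      simp only [kd, Prod.mk.injEq]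
      grind
    · simp only [hu, if_false, map_zero]
      grind
  · simp only [ht, if_false, ham_zero]
    grind

/-- The constant term of `{X, Y}` carries no half, which is why doubling the bracket produces `U +
U`. -/
theorem dbl_XY (hbr : ∀ a b, br.ham (p a) (p b) = (2 : ℂ) • coordBracket p a b) :
    dbl br (cycX p) (cycUp (matY p)) = 𝐔 + 𝐔 + 𝐔 * ι₁ (cycUp (matY p)) * ι₁ (cycX p)
      + 𝐔 * ι₂ (cycX p) * ι₂ (cycUp (matY p)) - 𝐒 * ι₁ (cycX p) * ι₂ (cycUp (matY p))
      + ι₁ (cycUp (matY p)) * ι₂ (cycX p) * 𝐒 := by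
  simp only [mul_assoc 𝐔, mul_assoc 𝐒, ← fstLeg_mul, ← sndLeg_mul, cycX_mul_cycUp, cycUp_mul_cycX]
  rw [vertexShift, vertexDiag]
  ext ⟨⟨k, s⟩, ⟨i, r⟩⟩ ⟨⟨j, t⟩, ⟨l, u⟩⟩
  simp only [Matrix.sub_apply, Matrix.add_apply, mul_diagonal, diagonal_mul, fstLeg_apply,
    sndLeg_apply, fstLeg_mul_sndLeg_apply, blockDiagonal_apply, diagonal_apply, Prod.mk.injEq]
  simp only [cycX_apply, cycY_apply, of_apply, dbl]
  by_cases ht : t = r + 1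
  · by_cases hu : s = u + 1
    · have hs : u = r - 1 ↔ r = u + 1 := by rw [eq_sub_iff_add_eq, eq_comm]
      have hr : r = u + 1 → r - 1 = u := fun e => by rw [e, add_sub_cancel_right]
      simp only [ht, hu, if_true, hbr, coordBracket, brXY, smul_sub, smul_add, mul_add,
        mul_smul_comm, two_smul_half, hs, add_sub_cancel_right, matX_apply, matY_apply, kd,
        add_left_inj]
      simp only [two_smul]
      grind
    · simp only [hu, if_false, map_zero]
      grind
  · simp only [ht, if_false, ham_zero]
    grind

end Pair

/-! ### Brackets of the spin factors `1 + W V`. -/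

section Spin

variable {m n : ℕ} {d : Fin m → ℕ} {B : Type} [CommRing B] [Algebra ℂ B]
  {p : Coord m n d → B} {br : SkewBiderivation B}

local notation "𝐒" => vertexDiag n m B

theorem isEven_vecMulVec {v w : Fin n × Fin m → B} {s : Fin m} (hw : ∀ P, P.2 ≠ s → w P = 0)
    (hv : ∀ P, P.2 ≠ s → v P = 0) : IsEven 𝐒 (vecMulVec w v) := by
  constructor <;>
  · ext ⟨⟨k, t⟩, ⟨i, r⟩⟩ ⟨⟨j, q⟩, ⟨l, u⟩⟩
    have h1 := hw (k, t)
    have h2 := hw (i, r)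
    have h3 := hv (j, q)
    have h4 := hv (l, u)
    simp only [vertexDiag, mul_diagonal, diagonal_mul, fstLeg_apply, sndLeg_apply, vecMulVec_apply]
    grind

/-- The identity drops out of `ι₂ g - ι₁ g`. The four terms that the Leibniz rule gives on `w k * v
l` are then exactly the four terms of the `Precedes` formula for the rank one matrix. -/
theorem precedes_one_add_vecMulVec {x : Matrix (Fin n × Fin m) (Fin n × Fin m) B}
    {v w : Fin n × Fin m → B} {s : Fin m} (hw : ∀ P, P.2 ≠ s → w P = 0)
    (hv : ∀ P, P.2 ≠ s → v P = 0)
    (hxw : ∀ i j k, br.ham (x i j) (w k) = (if k = j ∧ j.2 = s then (x *ᵥ w) i else 0)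
      - if k.2 = i.2 then x k j * w i else 0)
    (hxv : ∀ i j l, br.ham (x i j) (v l) = (if i = l ∧ l.2 = s then (v ᵥ* x) j else 0)
      - if j.2 = l.2 then v j * x i l else 0) :
    Precedes br 𝐒 x (1 + vecMulVec w v) := by
  have hN := isEven_vecMulVec hw hv
  have e : ι₂ (1 + vecMulVec w v) - ι₁ (1 + vecMulVec w v)
      = ι₂ (vecMulVec w v) - ι₁ (vecMulVec w v) := by
    rw [fstLeg_add, sndLeg_add, fstLeg_one, sndLeg_one]
    abel
  rw [Precedes, e, dbl_add_right, dbl_one_right, zero_add, mul_sub, sub_mul, ← hN.2, mul_sub,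
    ← mul_assoc, ← sndLeg_mul, ← hN.1, ← mul_assoc, sndLeg_mul_fstLeg, hN.2, mul_assoc 𝐒,
    sndLeg_mul_fstLeg, hN.1, mul_assoc 𝐒, ← fstLeg_mul, mul_vecMulVec, vecMulVec_mul]
  ext ⟨k, i⟩ ⟨j, l⟩
  have h1 := hw k
  have h2 := hv l
  simp only [vertexDiag, Matrix.sub_apply, mul_diagonal, diagonal_mul, fstLeg_mul_sndLeg_apply,
    fstLeg_apply, sndLeg_apply, vecMulVec_apply, dbl, of_apply, Derivation.leibniz, smul_eq_mul,
    hxw, hxv]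
  grind

/-- The column vector `W_a` in `⨁ 𝒱_s`. -/
def cycW (p : Coord m n d → B) (a : Spin d) : Fin n × Fin m → B :=
  fun P => if P.2 = a.1 then p (.w a P.1) else 0

/-- The row vector `V_a` on `⨁ 𝒱_s`. -/
def cycV (p : Coord m n d → B) (a : Spin d) : Fin n × Fin m → B :=
  fun P => if P.2 = a.1 then p (.v a P.1) else 0

theorem cycW_of_ne (a : Spin d) (P : Fin n × Fin m) (h : P.2 ≠ a.1) : cycW p a P = 0 := if_neg h

theorem cycV_of_ne (a : Spin d) (P : Fin n × Fin m) (h : P.2 ≠ a.1) : cycV p a P = 0 := if_neg h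

/-- `1 + W_a V_a` on `⨁ 𝒱_s`. -/
def spinFactor (p : Coord m n d → B) (a : Spin d) : Matrix (Fin n × Fin m) (Fin n × Fin m) B :=
  1 + vecMulVec (cycW p a) (cycV p a)

theorem isEven_spinFactor (a : Spin d) : IsEven 𝐒 (spinFactor p a) :=
  IsEven.one.add (isEven_vecMulVec (cycW_of_ne a) (cycV_of_ne a))

theorem spinFactor_eq (a : Spin d) : spinFactor p a = blockDiagonal fun s =>
    if a.1 = s then 1 + vecMulVec (vecW p a) (vecV p a) else 1 := by
  ext ⟨k, s⟩ ⟨j, t⟩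
  simp only [spinFactor, Matrix.add_apply, blockDiagonal_apply, vecMulVec_apply, cycW, cycV,
    one_apply, Prod.mk.injEq]
  by_cases h : a.1 = s
  · simp only [h, if_true, Matrix.add_apply, vecMulVec_apply, one_apply, vecW, vecV]
    grind
  · simp only [h, if_false, one_apply]
    grind

theorem cycV_dotProduct_cycW (a c : Spin d) :
    cycV p a ⬝ᵥ cycW p c = if a.1 = c.1 then vecV p a ⬝ᵥ vecW p c else 0 := by
  simp [dotProduct, cycV, cycW, Fintype.sum_prod_type, vecV, vecW, eq_comm]

variable [NeZero m]

theorem cycX_mulVec_cycW (a : Spin d) (i : Fin n) (r : Fin m) :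
    (cycX p *ᵥ cycW p a) (i, r) = if a.1 = r + 1 then (matX p r *ᵥ vecW p a) i else 0 := by
  simp [mulVec, dotProduct, cycX, cycW, Fintype.sum_prod_type, vecW]

theorem cycY_mulVec_cycW (a : Spin d) (i : Fin n) (r : Fin m) :
    (cycUp (matY p) *ᵥ cycW p a) (i, r)
      = if r = a.1 + 1 then (matY p a.1 *ᵥ vecW p a) i else 0 := by
  simp [mulVec, dotProduct, cycUp, cycW, Fintype.sum_prod_type, vecW]

theorem cycV_vecMul_cycX (a : Spin d) (j : Fin n) (t : Fin m) :
    (cycV p a ᵥ* cycX p) (j, t) = if t = a.1 + 1 then (vecV p a ᵥ* matX p a.1) j else 0 := by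
  simp only [vecMul, dotProduct, cycX, cycV, Fintype.sum_prod_type, vecV, of_apply, ite_mul,
    zero_mul, Finset.sum_ite_eq', Finset.mem_univ, if_true]
  simp only [mul_ite, mul_zero, Finset.sum_ite_irrel, Finset.sum_const_zero]

theorem cycV_vecMul_cycY (a : Spin d) (j : Fin n) (t : Fin m) :
    (cycV p a ᵥ* cycUp (matY p)) (j, t)
      = if a.1 = t + 1 then (vecV p a ᵥ* matY p t) j else 0 := by
  simp [vecMul, dotProduct, cycUp, cycV, Fintype.sum_prod_type, vecV, eq_comm]

theorem precedes_cycX (hbr : ∀ a b, br.ham (p a) (p b) = (2 : ℂ) • coordBracket p a b)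
    (a : Spin d) : Precedes br 𝐒 (cycX p) (spinFactor p a) := by
  refine precedes_one_add_vecMulVec (cycW_of_ne a) (cycV_of_ne a) ?_ ?_
  · rintro ⟨i, r⟩ ⟨j, t⟩ ⟨k, s⟩
    simp only [cycX_mulVec_cycW]
    simp only [cycX_apply, cycW]
    by_cases ht : t = r + 1
    · by_cases hs : s = a.1
      · simp only [ht, hs, if_true, hbr, coordBracket, brXW, smul_sub, two_smul_half, kd,
          matX_apply, vecW]
        grind
      · simp only [hs, if_false, map_zero]
        grind
    · simp only [ht, if_false, ham_zero]
      grind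
  · rintro ⟨i, r⟩ ⟨j, t⟩ ⟨l, u⟩
    simp only [cycV_vecMul_cycX]
    simp only [cycX_apply, cycV]
    by_cases ht : t = r + 1
    · by_cases hs : u = a.1
      · simp only [ht, hs, if_true, hbr, coordBracket, brXV, smul_sub, two_smul_half, kd,
          matX_apply, vecV]
        grind
      · simp only [hs, if_false, map_zero]
        grind
    · simp only [ht, if_false, ham_zero]
      grind

theorem precedes_cycY (hbr : ∀ a b, br.ham (p a) (p b) = (2 : ℂ) • coordBracket p a b)
    (a : Spin d) : Precedes br 𝐒 (cycUp (matY p)) (spinFactor p a) := by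
  refine precedes_one_add_vecMulVec (cycW_of_ne a) (cycV_of_ne a) ?_ ?_
  · rintro ⟨i, r⟩ ⟨j, t⟩ ⟨k, s⟩
    simp only [cycY_mulVec_cycW]
    simp only [cycY_apply, cycW]
    by_cases ht : r = t + 1
    · by_cases hs : s = a.1
      · simp only [ht, hs, if_true, hbr, coordBracket, brYW, smul_sub, two_smul_half, kd,
          matY_apply, vecW]
        grind
      · simp only [hs, if_false, map_zero]
        grind
    · simp only [ht, if_false, ham_zero]
      grind
  · rintro ⟨i, r⟩ ⟨j, t⟩ ⟨l, u⟩
    simp only [cycV_vecMul_cycY]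
    simp only [cycY_apply, cycV]
    by_cases ht : r = t + 1
    · by_cases hs : u = a.1
      · simp only [ht, hs, if_true, hbr, coordBracket, brYV, smul_sub, two_smul_half, kd,
          matY_apply, vecV]
        grind
      · simp only [hs, if_false, map_zero]
        grind
    · simp only [ht, if_false, ham_zero]
      grind

/-- The lexicographic order on the spin indices. -/
def SpinLT (a c : Spin d) : Prop := a.1 < c.1 ∨ a.1 = c.1 ∧ (a.2 : ℕ) < c.2

/-- For comparable spin indices exactly one of the two sign functions is nonzero, according to
whether the vertices differ, and the diagonal term of `{V, W}` is absent. -/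
theorem SpinLT.ordSign {a c : Spin d} (h : SpinLT a c) :
    (a.1 ≠ c.1 ∧ (ordSign a.1 c.1 : B) = 1 ∧ (ordSign c.1 a.1 : B) = -1
      ∧ (spinSign a c : B) = 0 ∧ (spinSign c a : B) = 0 ∨
    a.1 = c.1 ∧ (ordSign a.1 c.1 : B) = 0 ∧ (ordSign c.1 a.1 : B) = 0
      ∧ (spinSign a c : B) = 1 ∧ (spinSign c a : B) = -1) ∧ a ≠ c := by
  rcases h with h | ⟨h, h'⟩
  · refine ⟨Or.inl ⟨h.ne, ?_⟩, fun e => (e ▸ h.ne) rfl⟩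
    simp [CyclicQuiver.ordSign, spinSign, kd, h, h.not_gt, h.ne, h.ne']
  · refine ⟨Or.inr ⟨h, ?_⟩, fun e => ?_⟩
    · simp [CyclicQuiver.ordSign, spinSign, kd, h, h', h'.not_gt]
    · subst e
      exact lt_irrefl _ h'

/-- One formula covers equal and distinct vertices, because the vectors are extended by zero and the
dot product of vectors at distinct vertices vanishes. -/
theorem ham_cycV_cycW (hbr : ∀ a b, br.ham (p a) (p b) = (2 : ℂ) • coordBracket p a b)
    {a c : Spin d} (h : SpinLT a c) (j k : Fin n × Fin m) :
    br.ham (cycV p a j) (cycW p c k) = cycW p c k * cycV p a j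
      + if k = j ∧ j.2 = c.1 then cycV p a ⬝ᵥ cycW p c else 0 := by
  obtain ⟨j, t⟩ := j
  obtain ⟨k, s⟩ := k
  rw [cycV_dotProduct_cycW]
  simp only [cycV, cycW]
  by_cases ht : t = a.1
  · by_cases hs : s = c.1
    · obtain ⟨h | h, hne⟩ := h.ordSign (B := B) <;>
      · simp only [ht, hs, if_true, hbr, coordBracket, brVW, h, hne, kd, vecV, vecW,
          two_smul_half, smul_add, if_false, zero_mul, one_mul, smul_zero]
        grind
    · simp only [hs, if_false, map_zero]
      grind
  · simp only [ht, if_false, ham_zero]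
    grind

theorem ham_cycV_cycW' (hbr : ∀ a b, br.ham (p a) (p b) = (2 : ℂ) • coordBracket p a b)
    {a c : Spin d} (h : SpinLT a c) (l i : Fin n × Fin m) :
    br.ham (cycV p c l) (cycW p a i) = -(cycW p a i * cycV p c l
      + if i = l ∧ l.2 = c.1 then cycV p c ⬝ᵥ cycW p a else 0) := by
  obtain ⟨l, t⟩ := l
  obtain ⟨i, s⟩ := i
  rw [cycV_dotProduct_cycW]
  simp only [cycV, cycW]
  by_cases ht : t = c.1
  · by_cases hs : s = a.1
    · obtain ⟨h | h, hne⟩ := h.ordSign (B := B) <;>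
      · simp only [ht, hs, if_true, hbr, coordBracket, brVW, h, hne.symm, kd, vecV, vecW,
          two_smul_half, smul_add, if_false, zero_mul, neg_mul, one_mul, smul_neg, smul_zero]
        grind
    · simp only [hs, if_false, map_zero]
      grind
  · simp only [ht, if_false, ham_zero]
    grind

theorem ham_cycV_cycV (hbr : ∀ a b, br.ham (p a) (p b) = (2 : ℂ) • coordBracket p a b)
    {a c : Spin d} (h : SpinLT a c) (j l : Fin n × Fin m) :
    br.ham (cycV p a j) (cycV p c l) = -(cycV p a j * cycV p c l
      + if j.2 = l.2 then cycV p c j * cycV p a l else 0) := by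
  obtain ⟨j, t⟩ := j
  obtain ⟨l, s⟩ := l
  simp only [cycV]
  by_cases ht : t = a.1
  · by_cases hs : s = c.1
    · obtain ⟨h | h, hne⟩ := h.ordSign (B := B) <;>
      · simp only [ht, hs, if_true, hbr, coordBracket, brVV, h, vecV, two_smul_half,
          smul_add, smul_sub, smul_neg, one_mul, zero_mul, smul_zero]
        grind
    · simp only [hs, if_false, map_zero]
      grind
  · simp only [ht, if_false, ham_zero]
    grind

theorem ham_cycW_cycW (hbr : ∀ a b, br.ham (p a) (p b) = (2 : ℂ) • coordBracket p a b)
    {a c : Spin d} (h : SpinLT a c) (i k : Fin n × Fin m) :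
    br.ham (cycW p a i) (cycW p c k) = -(cycW p c k * cycW p a i
      + if i.2 = k.2 then cycW p a k * cycW p c i else 0) := by
  obtain ⟨i, t⟩ := i
  obtain ⟨k, s⟩ := k
  simp only [cycW]
  by_cases ht : t = a.1
  · by_cases hs : s = c.1
    · obtain ⟨h | h, hne⟩ := h.ordSign (B := B) <;>
      · simp only [ht, hs, if_true, hbr, coordBracket, brWW, h, vecW, two_smul_half,
          smul_add, smul_sub, smul_neg, one_mul, zero_mul, smul_zero]
        grind
    · simp only [hs, if_false, map_zero]
      grind
  · simp only [ht, if_false, ham_zero]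
    grind

/-- Here the lexicographic order becomes the fusion order: the signs `o` in the brackets of spin
variables are those required for the smaller index to precede the larger. -/
theorem precedes_spinFactor (hbr : ∀ a b, br.ham (p a) (p b) = (2 : ℂ) • coordBracket p a b)
    {a c : Spin d} (h : SpinLT a c) : Precedes br 𝐒 (spinFactor p a) (spinFactor p c) := by
  refine (Precedes.one _).add
    (precedes_one_add_vecMulVec (cycW_of_ne c) (cycV_of_ne c) ?_ ?_)
  · intro i j k
    rw [br.skew, vecMulVec_apply, Derivation.leibniz, smul_eq_mul, smul_eq_mul,
      br.skew _ (cycV p a j), br.skew _ (cycW p a i), ham_cycV_cycW hbr h, ham_cycW_cycW hbr h,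
      vecMulVec_mulVec]
    have h1 := cycW_of_ne (p := p) a k
    have h2 := cycW_of_ne (p := p) c i
    simp only [vecMulVec_apply, Pi.smul_apply, MulOpposite.smul_eq_mul_unop, MulOpposite.unop_op]
    grind
  · intro i j l
    rw [br.skew, vecMulVec_apply, Derivation.leibniz, smul_eq_mul, smul_eq_mul,
      br.skew _ (cycV p a j), ham_cycV_cycV hbr h, ham_cycV_cycW' hbr h, vecMul_vecMulVec]
    simp only [vecMulVec_apply, Pi.smul_apply, smul_eq_mul]
    grind

theorem ham_cycV_cycW_self (hbr : ∀ a b, br.ham (p a) (p b) = (2 : ℂ) • coordBracket p a b)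
    (a : Spin d) (j k : Fin n × Fin m) :
    br.ham (cycV p a j) (cycW p a k) = cycW p a k * cycV p a j
      + if k = j ∧ j.2 = a.1 then 2 + cycV p a ⬝ᵥ cycW p a else 0 := by
  obtain ⟨j, t⟩ := j
  obtain ⟨k, s⟩ := k
  rw [cycV_dotProduct_cycW]
  simp only [cycV, cycW]
  by_cases ht : t = a.1
  · by_cases hs : s = a.1
    · simp only [ht, hs, if_true, hbr, coordBracket, brVW, kd, vecV, vecW, two_smul_half,
        smul_add, ordSign, spinSign, lt_irrefl, if_false, one_mul]
      simp only [two_smul]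
      grind
    · simp only [hs, if_false, map_zero]
      grind
  · simp only [ht, if_false, ham_zero]
    grind

theorem ham_cycV_cycV_self (hbr : ∀ a b, br.ham (p a) (p b) = (2 : ℂ) • coordBracket p a b)
    (a : Spin d) (j l : Fin n × Fin m) : br.ham (cycV p a j) (cycV p a l) = 0 := by
  simp only [cycV]
  split_ifs <;> simp [hbr, coordBracket, brVV, ordSign, spinSign, ham_zero]

theorem ham_cycW_cycW_self (hbr : ∀ a b, br.ham (p a) (p b) = (2 : ℂ) • coordBracket p a b)
    (a : Spin d) (j l : Fin n × Fin m) : br.ham (cycW p a j) (cycW p a l) = 0 := by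
  simp only [cycW]
  split_ifs <;> simp [hbr, coordBracket, brWW, ordSign, spinSign, ham_zero]

/-- With `N = W V` one has `N * N = (V W) • N`, so the square of `1 + N` differs from `1` by `(2 + V
W) • N`. The coefficient `2 + V W` is the one in the doubled bracket of `V` with `W`. -/
theorem dbl_spinFactor_self (hbr : ∀ a b, br.ham (p a) (p b) = (2 : ℂ) • coordBracket p a b)
    (a : Spin d) : dbl br (spinFactor p a) (spinFactor p a)
      = 𝐒 * (ι₂ (spinFactor p a) * ι₂ (spinFactor p a))
        - 𝐒 * (ι₁ (spinFactor p a) * ι₁ (spinFactor p a)) := by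
  set N := vecMulVec (cycW p a) (cycV p a) with hN
  have hNN : N * N = (cycV p a ⬝ᵥ cycW p a) • N := by
    rw [hN, vecMulVec_mul_vecMulVec]
    ext i j
    simp [vecMulVec_apply]
    ring
  have e : 𝐒 * (ι₂ (spinFactor p a) * ι₂ (spinFactor p a))
        - 𝐒 * (ι₁ (spinFactor p a) * ι₁ (spinFactor p a))
        = 𝐒 * (ι₂ (N + N + N * N) - ι₁ (N + N + N * N)) := by
    rw [spinFactor, ← hN]
    simp only [fstLeg_add, sndLeg_add, fstLeg_one, sndLeg_one, fstLeg_mul, sndLeg_mul]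
    noncomm_ring
  rw [e, hNN, spinFactor, ← hN, dbl_add_left, dbl_one_left, zero_add, dbl_add_right,
    dbl_one_right, zero_add]
  ext ⟨k, i⟩ ⟨j, l⟩
  simp only [vertexDiag, diagonal_mul, Matrix.sub_apply, fstLeg_apply, sndLeg_apply,
    Matrix.add_apply, Matrix.smul_apply, smul_eq_mul, dbl, of_apply, hN, vecMulVec_apply]
  rw [Derivation.leibniz, br.skew _ (cycV p a l), br.skew _ (cycW p a k)]
  simp only [Derivation.leibniz, smul_eq_mul, br.skew (cycW p a k) (cycV p a j),
    ham_cycV_cycW_self hbr, ham_cycV_cycV_self hbr, ham_cycW_cycW_self hbr]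
  have h1 := cycW_of_ne (p := p) a i
  have h2 := cycW_of_ne (p := p) a k
  have h3 := cycV_of_ne (p := p) a l
  have h4 := cycV_of_ne (p := p) a j
  grind

end Spin

/-! ### The order of the spin indices, invertibility, and assembly. -/

section Assembly

variable {m n : ℕ} {d : Fin m → ℕ}

/-- `finSigmaFinEquiv` sends `(s, α)` to `d 0 + ⋯ + d (s - 1) + α`, so comparing partial sums shows
that it is increasing for the lexicographic order. -/
theorem rho_lt {c c' : Fin (∑ s, d s)} (h : c < c') : SpinLT (rho d c) (rho d c') := by
  have key : ∀ a b : Spin d, a.1 < b.1 → finSigmaFinEquiv a < finSigmaFinEquiv b := by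
    intro a b hab
    -- Extension by zero, only to write the partial sums over `Finset.range`; every index that
    -- occurs is below `m`, so the default value is never summed.
    let D : ℕ → ℕ := fun i => if h : i < m then d ⟨i, h⟩ else 0
    have hD : ∀ r : Fin m, ∑ i : Fin (r : ℕ), d (Fin.castLE r.2.le i) = ∑ i ∈ Finset.range r, D i := by
      intro r
      rw [← Fin.sum_univ_eq_sum_range D]
      exact Finset.sum_congr rfl fun i _ => by
        simp only [D, dif_pos (i.2.trans r.2)]
        rfl
    rw [Fin.lt_def, finSigmaFinEquiv_apply, finSigmaFinEquiv_apply, hD, hD]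
    have h1 : ∑ i ∈ Finset.range (a.1 + 1 : ℕ), D i ≤ ∑ i ∈ Finset.range b.1, D i :=
      Finset.sum_le_sum_of_subset (Finset.range_subset_range.mpr hab)
    rw [Finset.sum_range_succ, show D a.1 = d a.1 from dif_pos a.1.2] at h1
    have := a.2.2
    omega
  have e : ∀ x, finSigmaFinEquiv (rho d x) = x := fun x => Equiv.apply_symm_apply _ x
  rcases lt_trichotomy (rho d c).1 (rho d c').1 with h1 | h1 | h1
  · exact Or.inl h1
  · refine Or.inr ⟨h1, ?_⟩
    rw [← e c, ← e c', Fin.lt_def, finSigmaFinEquiv_apply, finSigmaFinEquiv_apply] at h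
    generalize rho d c = a at *
    generalize rho d c' = b at *
    obtain ⟨s, α⟩ := a
    obtain ⟨r, β⟩ := b
    obtain rfl : s = r := h1
    simpa using h
  · have := key _ _ h1
    rw [e, e] at this
    exact absurd this h.not_gt

variable {B : Type} [CommRing B] [Algebra ℂ B]
  {p : Coord m n d → B} {br : SkewBiderivation B} [NeZero m]

theorem blockDiagonal_momentMap_zero : blockDiagonal (momentMap p 0)
    = (1 + cycX p * cycUp (matY p))
      * blockDiagonal fun s => (1 + matY p (s - 1) * matX p (s - 1))⁻¹ := by
  rw [cycX_mul_cycUp, ← blockDiagonal_one, ← blockDiagonal_add, ← blockDiagonal_mul]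
  rfl

theorem blockDiagonal_momentMap_succ (c : Fin (∑ s, d s)) :
    blockDiagonal (momentMap p c.succ) = blockDiagonal (momentMap p c.castSucc)
      * blockDiagonal fun s => if (rho d c).1 = s then
        (1 + vecMulVec (vecW p (rho d c)) (vecV p (rho d c)))⁻¹ else 1 := by
  rw [← blockDiagonal_mul, momentMap, Fin.induction_succ]
  congr 1
  ext1 s
  split_ifs
  · rfl
  · rw [mul_one]
    rfl

theorem framedCyclic (hbr : ∀ a b, br.ham (p a) (p b) = (2 : ℂ) • coordBracket p a b)
    (hYX : ∀ s, IsUnit (1 + matY p s * matX p s).det)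
    (hWV : ∀ a, IsUnit (1 + vecMulVec (vecW p a) (vecV p a)).det) :
    FramedCyclic br (vertexDiag n m B) (vertexShift n m B) (cycX p) (cycUp (matY p))
      (blockDiagonal fun s => (1 + matY p (s - 1) * matX p (s - 1))⁻¹)
      (fun c => spinFactor p (rho d c))
      (fun c => blockDiagonal fun s => if (rho d c).1 = s then
        (1 + vecMulVec (vecW p (rho d c)) (vecV p (rho d c)))⁻¹ else 1)
      (fun b => blockDiagonal (momentMap p b)) where
  pair := ⟨flip_vertexDiag, isLowering_cycX, isRaising_cycUp _, dbl_XX hbr, dbl_YY hbr, dbl_XY hbr⟩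
  inv_K := by
    rw [cycUp_mul_cycX, ← blockDiagonal_one, ← blockDiagonal_add, ← blockDiagonal_mul]
    congr 1
    ext1 s
    -- The shift appears because `Y X` passes from vertex `s` through `s - 1`: its block at `s` is
    -- `Y_{s-1} X_{s-1}`.
    exact mul_nonsing_inv _ (hYX (s - 1))
  inv_g c := by
    rw [spinFactor_eq, ← blockDiagonal_mul, ← blockDiagonal_one]
    congr 1
    ext1 s
    split_ifs
    · exact mul_nonsing_inv _ (hWV _)
    · exact mul_one 1
  even_g c := isEven_spinFactor _
  X_prec c := precedes_cycX hbr _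
  Y_prec c := precedes_cycY hbr _
  g_prec c c' h := precedes_spinFactor hbr (rho_lt h)
  g_self c := dbl_spinFactor_self hbr _
  Φ_zero := blockDiagonal_momentMap_zero
  Φ_succ := blockDiagonal_momentMap_succ

theorem cycX_mul_inv (hX : ∀ s, IsUnit (matX p s).det) :
    cycX p * cycUp (fun s => (matX p s)⁻¹) = 1 := by
  rw [cycX_mul_cycUp, ← blockDiagonal_one]
  congr 1
  ext1 s
  exact mul_nonsing_inv _ (hX s)

/-- The block of `X⁻¹` from vertex `s` to vertex `s + 1` is a right inverse of `X_s`. This links the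
condition on the total `X` to the inverses in `Z_s`. -/
theorem isUnit_det_matX (h : IsUnit (cycX p).det) (s : Fin m) : IsUnit (matX p s).det := by
  have e := mul_nonsing_inv _ h
  apply isUnit_det_of_right_inverse (B := of fun j k => (cycX p)⁻¹ (j, s + 1) (k, s))
  ext i k
  have := congrFun (congrFun e (i, s)) (k, s)
  simp only [mul_apply, cycX, of_apply, Fintype.sum_prod_type, ite_mul, zero_mul,
    Finset.sum_ite_eq', Finset.mem_univ, if_true] at this
  rw [mul_apply]
  refine this.trans ?_
  simp [one_apply]

theorem cycUp_matZ : cycUp (matZ p) = cycUp (matY p) + cycUp fun s => (matX p s)⁻¹ := by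
  ext P Q
  simp only [cycUp, matZ, of_apply, Matrix.add_apply]
  split_ifs <;> simp

section Units

variable (f : PolyRing m n d)

theorem isUnit_of_dvd {g : PolyRing m n d} (h : g ∣ f) :
    IsUnit (algebraMap (PolyRing m n d) (RegFun f) g) :=
  isUnit_of_dvd_unit (map_dvd _ h) (IsLocalization.Away.algebraMap_isUnit f)

theorem isUnit_det_one_add_YX (h : denBullet m n d ∣ f) (s : Fin m) :
    IsUnit (1 + matY (coord f) s * matX (coord f) s).det := by
  have e : 1 + matY (coord f) s * matX (coord f) s
      = (algebraMap (PolyRing m n d) (RegFun f)).mapMatrix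
        (1 + matY MvPolynomial.X s * matX MvPolynomial.X s) := by
    rw [map_add, map_mul, map_one]
    rfl
  rw [e, ← RingHom.map_det]
  refine isUnit_of_dvd f (dvd_trans (Dvd.dvd.mul_right ?_ _) h)
  let F : Fin m → PolyRing m n d := fun s =>
    (1 + matX MvPolynomial.X s * matY MvPolynomial.X s).det
      * (1 + matY MvPolynomial.X s * matX MvPolynomial.X s).det
  have h2 : F s ∣ ∏ s, F s := Finset.dvd_prod_of_mem F (Finset.mem_univ s)
  exact dvd_of_mul_left_dvd h2

theorem isUnit_det_one_add_WV (h : denBullet m n d ∣ f) (a : Spin d) :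
    IsUnit (1 + vecMulVec (vecW (coord f) a) (vecV (coord f) a)).det := by
  have e : 1 + vecMulVec (vecW (coord f) a) (vecV (coord f) a)
      = (algebraMap (PolyRing m n d) (RegFun f)).mapMatrix
        (1 + vecMulVec (vecW MvPolynomial.X a) (vecV MvPolynomial.X a)) := by
    rw [map_add, map_one]
    congr 1
    ext i j
    simp [vecMulVec_apply, vecW, vecV, coord]
  rw [e, ← RingHom.map_det]
  refine isUnit_of_dvd f (dvd_trans (Dvd.dvd.mul_left ?_ _) h)
  let F : Spin d → PolyRing m n d := fun a =>
    (1 + vecMulVec (vecW MvPolynomial.X a) (vecV MvPolynomial.X a)).det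
      * (1 + vecV MvPolynomial.X a ⬝ᵥ vecW MvPolynomial.X a)
  have h2 : F a ∣ ∏ a, F a := Finset.dvd_prod_of_mem F (Finset.mem_univ a)
  exact dvd_of_mul_right_dvd h2

theorem isUnit_det_cycX : IsUnit (cycX (coord (denCirc m n d))).det := by
  have e : cycX (coord (denCirc m n d))
      = (algebraMap (PolyRing m n d) (RegFun (denCirc m n d))).mapMatrix
        (cycX MvPolynomial.X) := by
    ext P Q
    simp only [cycX, of_apply, RingHom.mapMatrix_apply, map_apply]
    split_ifs
    · rfl
    · rw [map_zero]
  rw [e, ← RingHom.map_det]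
  exact isUnit_of_dvd _ (dvd_mul_left _ _)

theorem quasiPoisson_ham_coord (a b : Coord m n d) :
    (quasiPoisson f).ham (coord f a) (coord f b) = (2 : ℂ) • coordBracket (coord f) a b := by
  rw [quasiPoisson_ham, bracket_coord]

theorem isAbelianPoissonAlgebra_traceAlgebra {L : Fin m → Matrix (Fin n) (Fin n) (RegFun f)}
    (h : ∀ (b c : Fin (∑ s, d s + 1)) (k l : ℕ),
      bracket f (traceFun (coord f) L b k) (traceFun (coord f) L c l) = 0) :
    IsAbelianPoissonAlgebra (bracket f) (traceAlgebra (coord f) L) := by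
  refine isAbelianPoissonAlgebra_adjoin f ?_
  rintro _ ⟨b, k, rfl⟩ _ ⟨c, l, rfl⟩
  exact h b c k l

end Units
end Assembly
end CyclicQuiver

open CyclicQuiver in
theorem proposition3p10 (m n : ℕ) [NeZero m] (hm : 2 ≤ m) (hn : 1 ≤ n)
    (d : Fin m → ℕ) (hd : 1 ≤ d 0) :
    -- the case `L = Y`, on the variety `𝓜^•`
    ((∀ (b c : Fin (∑ s, d s + 1)) (k l : ℕ),
        bracket (denBullet m n d)
          (traceFun (coord (denBullet m n d)) (matY (coord (denBullet m n d))) b k)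
          (traceFun (coord (denBullet m n d)) (matY (coord (denBullet m n d))) c l) = 0) ∧
      IsAbelianPoissonAlgebra (bracket (denBullet m n d))
        (traceAlgebra (coord (denBullet m n d)) (matY (coord (denBullet m n d))))) ∧
    -- the case `L = Z`, on the variety `𝓜^∘`
    ((∀ (b c : Fin (∑ s, d s + 1)) (k l : ℕ),
        bracket (denCirc m n d)
          (traceFun (coord (denCirc m n d)) (matZ (coord (denCirc m n d))) b k)
          (traceFun (coord (denCirc m n d)) (matZ (coord (denCirc m n d))) c l) = 0) ∧
      IsAbelianPoissonAlgebra (bracket (denCirc m n d))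
        (traceAlgebra (coord (denCirc m n d)) (matZ (coord (denCirc m n d))))) := by
  have hY : ∀ (b c : Fin (∑ s, d s + 1)) (k l : ℕ),
      bracket (denBullet m n d)
        (traceFun (coord (denBullet m n d)) (matY (coord (denBullet m n d))) b k)
        (traceFun (coord (denBullet m n d)) (matY (coord (denBullet m n d))) c l) = 0 :=
    fun b c k l => quasiPoisson_ham_eq_zero _
      ((framedCyclic (quasiPoisson_ham_coord _) (isUnit_det_one_add_YX _ dvd_rfl)
        (isUnit_det_one_add_WV _ dvd_rfl)).ham_trace_trace_Y b c k l)
  have hZ : ∀ (b c : Fin (∑ s, d s + 1)) (k l : ℕ),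
      bracket (denCirc m n d)
        (traceFun (coord (denCirc m n d)) (matZ (coord (denCirc m n d))) b k)
        (traceFun (coord (denCirc m n d)) (matZ (coord (denCirc m n d))) c l) = 0 := by
    intro b c k l
    refine quasiPoisson_ham_eq_zero _ ?_
    rw [traceFun, traceFun, cycUp_matZ]
    exact (framedCyclic (quasiPoisson_ham_coord _)
      (isUnit_det_one_add_YX _ (dvd_mul_right _ _))
      (isUnit_det_one_add_WV _ (dvd_mul_right _ _))).ham_trace_trace_Z
      (cycX_mul_inv (isUnit_det_matX isUnit_det_cycX)) b c k l
  exact ⟨⟨hY, isAbelianPoissonAlgebra_traceAlgebra _ hY⟩,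
    hZ, isAbelianPoissonAlgebra_traceAlgebra _ hZ⟩
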